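/- Let $(Y_n)_{n\ge 0}$ be the number of rounds of the maximum-finding Algorithm A of Chen and Hwang (2003) for $n$ processors, that is, real random variables with $Y_0=Y_1=1$ whose laws satisfy, for all $n\ge 2$, $$Y_n \stackrel{\mathcal L}{=} Y^{(1)}_{I_1^{(n)}}+Y^{(2)}_{I_2^{(n)}}+1,$$ where $(Y^{(1)}_k)_{k\ge0}$ and $(Y^{(2)}_k)_{k\ge0}$ are distributional copies of $(Y_k)_{k\ge0}$, the three objects $(Y^{(1)}_k)$, $(Y^{(2)}_k)$ and $(I_1^{(n)},I_2^{(n)})$ are independent, and $$\mathbb P\big((I_1^{(n)},I_2^{(n)})=(j,k)\big)=\begin{cases}2^{-n}, & (j,k)=(0,0),\\ \binom{n-k-1}{j-1}2^{-n}, & k\ge 0,\ 1\le j\le n-k,\\ 0, & \text{otherwise.}\end{cases}$$ For probability measures $\mu,\nu$ on $\mathbb R$ let $\zeta_3(\mu,\nu)=\sup_{f}\left|\int f\,d\mu-\int f\,d\nu\right|$, the supremum being over all $f\in C^2(\mathbb R,\mathbb R)$ with $|f''(x)-f''(y)|\le|x-y|$ for all $x,y\in\mathbb R$; for random variables, $\zeta_3$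 denotes the distance of their laws. Then $\mathbb E|Y_n|^3<\infty$ for all $n$, there is a constant $C>0$ such that $$\frac{Y_n-\mathbb E Y_n}{\sqrt{C\ln n}}\xrightarrow{\ \mathcal L\ }\mathcal N(0,1)\qquad(n\to\infty),$$ and $$\zeta_3\left(\frac{Y_n-\mathbb E Y_n}{\sqrt{\operatorname{Var}(Y_n)}},\ \mathcal N(0,1)\right)=O\left(\frac1{\sqrt{\ln n}}\right)\qquad(n\to\infty).$$ -/

import Mathlib

open MeasureTheory ProbabilityTheory Filter
open scoped ENNReal Topology

namespace MaxFinding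

/-- The class `𝓕₃` of twice continuously differentiable `f : ℝ → ℝ` whose second derivative is
Lipschitz continuous with constant `1`. -/
def lipschitzTwo : Set (ℝ → ℝ) :=
  {f | ContDiff ℝ 2 f ∧ ∀ x y : ℝ, |iteratedDeriv 2 f x - iteratedDeriv 2 f y| ≤ |x - y|}

/-- The Zolotarev distance `ζ₃(μ, ν) = sup_{f ∈ 𝓕₃} |∫ f dμ - ∫ f dν| ∈ [0, ∞]` of two probability
measures on `ℝ`. (Every `f ∈ 𝓕₃` grows at most cubically, so all the integrals exist when `μ` and
`ν` have finite third absolute moments.) -/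
noncomputable def zolotarev3 (μ ν : Measure ℝ) : ℝ≥0∞ :=
  ⨆ f ∈ lipschitzTwo, ENNReal.ofReal |(∫ x, f x ∂μ) - ∫ x, f x ∂ν|

/-- The probability `ℙ((I₁⁽ⁿ⁾, I₂⁽ⁿ⁾) = (j, k))` that, started with `n` processors, Algorithm A
calls itself on `j` and on `k` processors: `2⁻ⁿ` for `(j, k) = (0, 0)`,
`binom(n - k - 1, j - 1) 2⁻ⁿ` for `k ≥ 0` and `1 ≤ j ≤ n - k`, and `0` otherwise. -/
noncomputable def splitProb (n j k : ℕ) : ℝ :=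
  if j = 0 ∧ k = 0 then (1 / 2 : ℝ) ^ n
  else if 1 ≤ j ∧ j + k ≤ n then ((n - k - 1).choose (j - 1) : ℝ) * (1 / 2 : ℝ) ^ n
  else 0

/-- `Y n` is (distributed as) the number of rounds of Algorithm A with `n` processors:
`Y 0 = Y 1 = 1`, and for `n ≥ 2` the variable `Y n` has the same law as
`V_I + W_J + 1`, where `V = (V_k)` and `W = (W_k)` are distributional copies of `Y` (only the laws of
the individual `V_k`, `W_k` matter), the pair `(I, J)` has the law `splitProb n`, and `V`, `W`,
`(I, J)` are independent. -/
structure IsRounds {Ω : Type*} [MeasurableSpace Ω] (P : Measure Ω) (Y : ℕ → Ω → ℝ) : Prop where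
  aemeasurable : ∀ n, AEMeasurable (Y n) P
  zero : ∀ᵐ ω ∂P, Y 0 ω = 1
  one : ∀ᵐ ω ∂P, Y 1 ω = 1
  recurrence : ∀ n, 2 ≤ n →
    ∃ (Ω' : Type) (_ : MeasurableSpace Ω') (P' : Measure Ω') (_ : IsProbabilityMeasure P')
      (V W : ℕ → Ω' → ℝ) (I J : Ω' → ℕ),
      (∀ k, Measurable (V k)) ∧ (∀ k, Measurable (W k)) ∧ Measurable I ∧ Measurable J ∧
      (∀ k, IdentDistrib (V k) (Y k) P' P) ∧
      (∀ k, IdentDistrib (W k) (Y k) P' P) ∧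
      (∀ j k, P'.real {ω | I ω = j ∧ J ω = k} = splitProb n j k) ∧
      -- the three objects `V`, `W` and `(I, J)` are mutually independent
      IndepFun (fun ω k => V k ω) (fun ω => ((fun k => W k ω), (I ω, J ω))) P' ∧
      IndepFun (fun ω k => W k ω) (fun ω => (I ω, J ω)) P' ∧
      IdentDistrib (Y n) (fun ω => V (I ω) ω + W (J ω) ω + 1) P P'

/- The recurrence is not vacuous: it has a solution. This part serves only as a consistency check of
the definition `IsRounds`; the theorem does not refer to it. -/

namespace Existence

lemma splitProb_nonneg (n j k : ℕ) : 0 ≤ splitProb n j k := by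
  unfold splitProb; split_ifs <;> positivity

lemma splitProb_zero_right (n k : ℕ) (hk : k ≠ 0) : splitProb n 0 k = 0 := by
  simp [splitProb, hk]

lemma sum_splitProb (n : ℕ) (hn : 1 ≤ n) :
    ∑ p ∈ Finset.range (n + 1) ×ˢ Finset.range (n + 1), splitProb n p.1 p.2 = 1 := by
  rw [Finset.sum_product_right]
  have h1 : ∀ k ∈ Finset.range n, ∑ j ∈ Finset.range (n + 1), splitProb n j k
      = (if k = 0 then (1 / 2 : ℝ) ^ n else 0) + (1 / 2 : ℝ) ^ (k + 1) := by
    intro k hk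
    have hk := Finset.mem_range.1 hk
    obtain ⟨m, rfl⟩ : ∃ m, n = k + 1 + m := ⟨n - k - 1, by omega⟩
    rw [Finset.sum_range_succ', add_comm]
    congr 1
    · simp [splitProb]
    · rw [show k + 1 + m = (m + 1) + k by omega, Finset.sum_range_add]
      rw [Finset.sum_eq_zero (s := Finset.range k) (fun x _ => by
        rw [splitProb, if_neg (by omega), if_neg (by omega)]), add_zero]
      have : ∀ j ∈ Finset.range (m + 1), splitProb (m + 1 + k) (j + 1) k
          = (m.choose j : ℝ) * (1 / 2 : ℝ) ^ (m + 1 + k) := by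
        intro j hj
        have := Finset.mem_range.1 hj
        rw [splitProb, if_neg (by omega), if_pos (by omega)]
        simp
      rw [Finset.sum_congr rfl this, ← Finset.sum_mul, ← Nat.cast_sum, Nat.sum_range_choose]
      rw [show m + 1 + k = m + (k + 1) by omega, pow_add, ← mul_assoc]
      simp
  rw [Finset.sum_range_succ, Finset.sum_congr rfl h1, Finset.sum_add_distrib]
  have h2 : ∑ j ∈ Finset.range (n + 1), splitProb n j n = 0 := by
    apply Finset.sum_eq_zero
    intro j _
    rw [splitProb, if_neg (by omega), if_neg (by omega)]
  rw [h2, Finset.sum_ite_eq' ]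
  have h3 : ∀ n : ℕ, ∑ k ∈ Finset.range n, (1 / 2 : ℝ) ^ (k + 1) = 1 - (1 / 2 : ℝ) ^ n := by
    intro n
    induction n with
    | zero => simp
    | succ m ih => rw [Finset.sum_range_succ, ih]; ring
  rw [h3, if_pos (Finset.mem_range.2 hn)]
  ring

/-- The law of the pair of indices. -/
noncomputable def splitLaw (n : ℕ) : Measure (ℕ × ℕ) :=
  ∑ p ∈ Finset.range (n + 1) ×ˢ Finset.range (n + 1),
    ENNReal.ofReal (splitProb n p.1 p.2) • Measure.dirac p

lemma splitLaw_prob (n : ℕ) (hn : 1 ≤ n) : IsProbabilityMeasure (splitLaw n) := by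
  constructor
  simp [splitLaw]
  rw [← ENNReal.ofReal_sum_of_nonneg (fun _ _ => splitProb_nonneg _ _ _), sum_splitProb n hn]
  simp

lemma splitProb_eq_zero (n j k : ℕ) (h : n < j ∨ n < k) : splitProb n j k = 0 := by
  rw [splitProb, if_neg (by omega), if_neg (by omega)]

lemma splitLaw_singleton (n j k : ℕ) : (splitLaw n).real {(j, k)} = splitProb n j k := by
  have : splitLaw n {(j, k)} = ENNReal.ofReal (splitProb n j k) := by
    simp only [splitLaw, Measure.coe_finsetSum, Finset.sum_apply, Measure.smul_apply, smul_eq_mul]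
    rw [Finset.sum_eq_single (j, k)]
    · simp
    · intro b _ hb; simp [hb]
    · intro h
      rw [splitProb_eq_zero]; simp
      simp at h; omega
  rw [Measure.real, this, ENNReal.toReal_ofReal (splitProb_nonneg _ _ _)]

/-- The law of `V + W + 1` for independent `V ∼ ν j` and `W ∼ ν k`, where `p = (j, k)`. -/
noncomputable def step (ν : ℕ → Measure ℝ) (p : ℕ × ℕ) : Measure ℝ :=
  ((ν p.1).prod (ν p.2)).map (fun x => x.1 + x.2 + 1)

/-- The part of the recurrence without the index pair `(n, 0)`, which refers to `Y n` itself. -/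
noncomputable def rest (n : ℕ) (ν : ℕ → Measure ℝ) : Measure ℝ :=
  ∑ p ∈ (Finset.range (n + 1) ×ˢ Finset.range (n + 1)).erase (n, 0),
    ENNReal.ofReal (splitProb n p.1 p.2) • step ν p

lemma rest_congr (n : ℕ) (hn : 2 ≤ n) (ν ν' : ℕ → Measure ℝ) (h : ∀ k < n, ν k = ν' k) :
    rest n ν = rest n ν' := by
  apply Finset.sum_congr rfl
  rintro ⟨j, k⟩ hp
  by_cases h' : j < n ∧ k < n
  · simp [step, h j h'.1, h k h'.2]
  · simp at hp
    have : splitProb n j k = 0 := by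
      rw [splitProb, if_neg (by omega), if_neg (by omega)]
    simp [this]

/-- The solution `ν` of `ν = 2⁻ⁿ • (law of V + 2 for V ∼ ν) + R`. -/
noncomputable def lawAux (n : ℕ) (R : Measure ℝ) : Measure ℝ :=
  Measure.sum (fun m : ℕ => (ENNReal.ofReal ((1/2)^n)) ^ m • R.map (fun x : ℝ => x + 2 * (m : ℝ)))

lemma lawAux_eq (n : ℕ) (R : Measure ℝ) :
    lawAux n R = ENNReal.ofReal ((1/2)^n) • (lawAux n R).map (fun x => x + 2) + R := by
  ext s hs
  have hm : Measurable (fun x : ℝ => x + 2) := by fun_prop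
  rw [lawAux, Measure.add_apply, Measure.smul_apply, Measure.map_apply hm hs,
    Measure.sum_apply _ hs, Measure.sum_apply _ (hm hs), smul_eq_mul, ← ENNReal.tsum_mul_left]
  rw [tsum_eq_zero_add' ENNReal.summable, add_comm]
  congr 1
  · refine tsum_congr fun m => ?_
    have h1 : Measurable (fun x : ℝ => x + 2 * (m : ℝ)) := by fun_prop
    have h2 : Measurable (fun x : ℝ => x + 2 * ((m + 1 : ℕ) : ℝ)) := by fun_prop
    rw [Measure.smul_apply, Measure.smul_apply, Measure.map_apply h2 hs,
      Measure.map_apply h1 (hm hs), smul_eq_mul, smul_eq_mul, pow_succ', mul_assoc]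
    congr 3
    ext x; simp only [Set.mem_preimage]; push_cast; ring_nf
  · simp

lemma step_prob (ν : ℕ → Measure ℝ) (h : ∀ k, IsProbabilityMeasure (ν k)) (p) :
    IsProbabilityMeasure (step ν p) := by
  have := h p.1
  have := h p.2
  exact Measure.isProbabilityMeasure_map (by fun_prop)

lemma splitProb_n (n : ℕ) (hn : 1 ≤ n) : splitProb n n 0 = (1/2)^n := by
  rw [splitProb, if_neg (by omega), if_pos (by omega)]; simp

lemma sum_step (n : ℕ) (hn : 2 ≤ n) (ν : ℕ → Measure ℝ) (hprob : ∀ k < n, IsProbabilityMeasure (ν k))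
    (h0 : ν 0 = Measure.dirac 1) (h : ν n = lawAux n (rest n ν)) :
    IsProbabilityMeasure (ν n) ∧ ν n = ∑ p ∈ (Finset.range (n + 1) ×ˢ Finset.range (n + 1)),
      ENNReal.ofReal (splitProb n p.1 p.2) • step ν p := by
  have hmem : (n, 0) ∈ Finset.range (n + 1) ×ˢ Finset.range (n + 1) := by simp
  have hP : IsProbabilityMeasure (ν n) := by
    constructor
    have hR : rest n ν Set.univ = ENNReal.ofReal (1 - (1/2)^n) := by
      rw [rest_congr n hn ν (fun k => if k < n then ν k else Measure.dirac 1)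
        (by intro k hk; simp [hk])]
      have hh : ∀ k, IsProbabilityMeasure ((fun k => if k < n then ν k else Measure.dirac 1) k) := by
        intro k; dsimp only; split_ifs with hk
        · exact hprob k hk
        · infer_instance
      simp only [rest, Measure.coe_finsetSum, Finset.sum_apply, Measure.smul_apply, smul_eq_mul]
      rw [Finset.sum_congr rfl (fun p _ => by
        have := step_prob _ hh p
        rw [measure_univ, mul_one])]
      rw [← ENNReal.ofReal_sum_of_nonneg (fun _ _ => splitProb_nonneg _ _ _)]
      congr 1
      have := Finset.add_sum_erase _ (fun p : ℕ × ℕ => splitProb n p.1 p.2) hmem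
      rw [sum_splitProb n (by omega)] at this
      simp only [splitProb_n n (by omega)] at this
      linarith
    rw [h, lawAux, Measure.sum_apply _ MeasurableSet.univ]
    have : ∀ m : ℕ, ((ENNReal.ofReal ((1/2)^n)) ^ m •
      (rest n ν).map (fun x => x + 2 * (m : ℝ))) Set.univ
        = (ENNReal.ofReal ((1/2)^n)) ^ m * ENNReal.ofReal (1 - (1/2)^n) := by
      intro m
      rw [Measure.smul_apply, Measure.map_apply (by fun_prop) MeasurableSet.univ, Set.preimage_univ,
        hR, smul_eq_mul]
    simp_rw [this]
    rw [ENNReal.tsum_mul_right, ENNReal.tsum_geometric]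
    have hlt : ((1/2 : ℝ))^n < 1 := pow_lt_one₀ (by norm_num) (by norm_num) (by omega)
    rw [show (1 : ℝ≥0∞) - ENNReal.ofReal ((1/2)^n) = ENNReal.ofReal (1 - (1/2)^n) by
      rw [ENNReal.ofReal_sub _ (by positivity)]; simp]
    apply ENNReal.inv_mul_cancel
    · rw [Ne, ENNReal.ofReal_eq_zero]; linarith
    · simp
  refine ⟨hP, ?_⟩
  rw [← Finset.add_sum_erase _ _ hmem]
  conv_lhs => rw [h, lawAux_eq, ← h]
  congr 1
  simp only [splitProb_n n (by omega)]
  congr 1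
  simp only [step, h0]
  rw [Measure.prod_dirac, Measure.map_map (by fun_prop) (by fun_prop)]
  congr 1
  ext x; simp; ring

/-- The law of the number of rounds. -/
noncomputable def law : ℕ → Measure ℝ := fun n =>
  Nat.strongRec (motive := fun _ => Measure ℝ) (fun n ih =>
    if n < 2 then Measure.dirac 1 else
      lawAux n (rest n (fun k => if h : k < n then ih k h else 0))) n

lemma law_eq (n : ℕ) : law n = if n < 2 then Measure.dirac 1 else lawAux n (rest n law) := by
  conv_lhs => rw [law, Nat.strongRec_eq]
  split_ifs with h
  · rfl
  · congr 1
    apply rest_congr n (by omega)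
    intro k hk
    rw [dif_pos hk, law]

lemma law_prob (n : ℕ) : IsProbabilityMeasure (law n) := by
  induction n using Nat.strong_induction_on with
  | _ n ih =>
    by_cases h : n < 2
    · rw [law_eq, if_pos h]; infer_instance
    · exact (sum_step n (by omega) law ih (by rw [law_eq]; simp) (by rw [law_eq, if_neg h])).1

instance (n : ℕ) : IsProbabilityMeasure (law n) := law_prob n

lemma law_rec (n : ℕ) (hn : 2 ≤ n) : law n = ∑ p ∈ (Finset.range (n + 1) ×ˢ Finset.range (n + 1)),
      ENNReal.ofReal (splitProb n p.1 p.2) • step law p :=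
  (sum_step n hn law (fun k _ => law_prob k) (by rw [law_eq]; simp)
    (by rw [law_eq, if_neg (by omega)])).2

/-- A sequence satisfying `IsRounds` exists. -/
theorem exists_isRounds : ∃ (Y : ℕ → (ℕ → ℝ) → ℝ), IsRounds (Measure.infinitePi law) Y := by
  have hev : ∀ k, Measure.map (fun ω : ℕ → ℝ => ω k) (Measure.infinitePi law) = law k :=
    fun k => Measure.infinitePi_map_eval law k
  have hae : ∀ k, AEMeasurable (fun ω : ℕ → ℝ => ω k) (Measure.infinitePi law) :=
    fun k => (measurable_pi_apply k).aemeasurable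
  refine ⟨fun n ω => ω n, ⟨hae, ?_, ?_, ?_⟩⟩
  · have : ∀ᵐ x ∂(law 0), x = 1 := by rw [law_eq]; simp [ae_dirac_eq]
    rw [← hev 0] at this
    exact ae_of_ae_map (hae _) this
  · have : ∀ᵐ x ∂(law 1), x = 1 := by rw [law_eq]; simp [ae_dirac_eq]
    rw [← hev 1] at this
    exact ae_of_ae_map (hae _) this
  intro n hn
  have hQ := splitLaw_prob n (by omega)
  set μ := Measure.infinitePi law
  refine ⟨(ℕ → ℝ) × ((ℕ → ℝ) × (ℕ × ℕ)), inferInstance, μ.prod (μ.prod (splitLaw n)),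
    inferInstance, fun k ω => ω.1 k, fun k ω => ω.2.1 k, fun ω => ω.2.2.1, fun ω => ω.2.2.2,
    by fun_prop, by fun_prop, by fun_prop, by fun_prop, ?_, ?_, ?_, ?_, ?_, ?_⟩
  · intro k
    refine ⟨by fun_prop, hae k, ?_⟩
    have := (measurePreserving_fst (μ := μ) (ν := μ.prod (splitLaw n))).map_eq
    conv_rhs => rw [← this, Measure.map_map (by fun_prop) (by fun_prop)]
    rfl
  · intro k
    refine ⟨by fun_prop, hae k, ?_⟩
    have := ((measurePreserving_fst (μ := μ) (ν := splitLaw n)).comp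
      (measurePreserving_snd (μ := μ) (ν := μ.prod (splitLaw n)))).map_eq
    conv_rhs => rw [← this, Measure.map_map (by fun_prop) (by fun_prop)]
    rfl
  · intro j k
    have := ((measurePreserving_snd (μ := μ) (ν := splitLaw n)).comp
      (measurePreserving_snd (μ := μ) (ν := μ.prod (splitLaw n)))).measureReal_preimage
        (s := {(j, k)}) (by measurability)
    rw [← splitLaw_singleton, ← this]
    congr 1
    ext ω; simp [Prod.ext_iff]
  · exact indepFun_prod (X := id) (Y := id) measurable_id measurable_id
  · have := indepFun_prod (μ := μ) (ν := splitLaw n) (X := id) (Y := id) measurable_id measurable_id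
    have hmp := (measurePreserving_snd (μ := μ) (ν := μ.prod (splitLaw n)))
    rw [← hmp.map_eq] at this
    rw [indepFun_iff_measure_inter_preimage_eq_mul] at this ⊢
    intro s t hs ht
    have := this s t hs ht
    rw [Measure.map_apply (by fun_prop) (by measurability), Measure.map_apply (by fun_prop)
      (by measurability), Measure.map_apply (by fun_prop) (by measurability)] at this
    exact this
  · have hF : Measurable (fun ω : (ℕ → ℝ) × ((ℕ → ℝ) × (ℕ × ℕ)) =>
        ω.1 ω.2.2.1 + ω.2.1 ω.2.2.2 + 1) := by
      have h1 : Measurable (fun q : (ℕ → ℝ) × ℕ => q.1 q.2) := by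
        apply measurable_from_prod_countable_left
        intro k; fun_prop
      exact ((h1.comp (by fun_prop : Measurable fun ω : (ℕ → ℝ) × ((ℕ → ℝ) × (ℕ × ℕ)) =>
        (ω.1, ω.2.2.1))).add (h1.comp (by fun_prop : Measurable
          fun ω : (ℕ → ℝ) × ((ℕ → ℝ) × (ℕ × ℕ)) => (ω.2.1, ω.2.2.2)))).add_const 1
    refine ⟨hae n, hF.aemeasurable, ?_⟩
    rw [hev n, law_rec n hn]
    ext s hs
    rw [Measure.map_apply hF hs, Measure.prod_apply (hF hs)]
    simp only [Measure.coe_finsetSum, Finset.sum_apply, Measure.smul_apply, smul_eq_mul]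
    have key : ∀ v : ℕ → ℝ, (μ.prod (splitLaw n))
        (Prod.mk v ⁻¹' ((fun ω : (ℕ → ℝ) × ((ℕ → ℝ) × (ℕ × ℕ)) =>
        ω.1 ω.2.2.1 + ω.2.1 ω.2.2.2 + 1) ⁻¹' s)) =
        ∑ p ∈ (Finset.range (n + 1) ×ˢ Finset.range (n + 1)),
          ENNReal.ofReal (splitProb n p.1 p.2) * law p.2 {y | v p.1 + y + 1 ∈ s} := by
      intro v
      rw [Measure.prod_apply_symm (by exact measurable_prodMk_left (hF hs))]
      rw [splitLaw, lintegral_finsetSum_measure]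
      refine Finset.sum_congr rfl fun p _ => ?_
      rw [lintegral_smul_measure, lintegral_dirac, smul_eq_mul, ← hev p.2,
        Measure.map_apply (by fun_prop)]
      · rfl
      · exact (by fun_prop : Measurable fun y : ℝ => v p.1 + y + 1) hs
    simp_rw [key]
    have hmeas : ∀ p : ℕ × ℕ, Measurable fun x : ℝ => law p.2 {y | x + y + 1 ∈ s} := by
      intro p
      exact measurable_measure_prodMk_left
        ((by fun_prop : Measurable fun q : ℝ × ℝ => q.1 + q.2 + 1) hs)
    rw [lintegral_finsetSum]
    · refine Finset.sum_congr rfl fun p _ => ?_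
      have h2 := (hmeas p).comp (measurable_pi_apply (X := fun _ => ℝ) p.1)
      rw [show (∫⁻ a : ℕ → ℝ, ENNReal.ofReal (splitProb n p.1 p.2) *
        law p.2 {y | a p.1 + y + 1 ∈ s} ∂μ) = ENNReal.ofReal (splitProb n p.1 p.2) *
        ∫⁻ a : ℕ → ℝ, law p.2 {y | a p.1 + y + 1 ∈ s} ∂μ from lintegral_const_mul _ h2]
      congr 1
      rw [step, Measure.map_apply (by fun_prop) hs, Measure.prod_apply
        ((by fun_prop : Measurable fun q : ℝ × ℝ => q.1 + q.2 + 1) hs)]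
      rw [← hev p.1]
      exact lintegral_map (hmeas p) (measurable_pi_apply p.1)
    · intro p _
      exact ((hmeas p).comp (measurable_pi_apply (X := fun _ => ℝ) p.1)).const_mul _

end Existence

end MaxFinding

/-!
With `n` processors flipping fair coins, the first subproblem size `I` is binomial with parameters
`n` and `1 / 2`, and the second one, `J`, is a truncated geometric variable, so that `J = O(1)`.
Hence the number of rounds is, up to small corrections, a sum of about `log₂ n` independent copies
of `Y_G + 1` with `G` geometric, and the central limit law holds with a variance proportional to
`log n`. The proof makes this quantitative through recurrences `x = T x + ε`, where `T` is the
binomial average `binomMean`.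

*Scalar recurrences.* The harmonic numbers satisfy `T H = H - log 2` up to an exponentially small
error (`binomMean_harmonic`), and `1 / (n + 1)` is almost an eigenfunction of `T`
(`binomMean_inv`). With these as barriers, the maximum principle `le_of_binomMean_le` shows that
`x = T x + σ + O(1 / n)` implies `x = (σ / log 2) H + O(1)`, and that `x = T x / 2 + O(1 / n²)`
implies `x = O(1 / n)`.

*Mean and variance.* The second principle bounds the increments of the mean by `O(1 / n)`.
Therefore the mean at `I` has variance `O(1 / n)`, by the Efron–Stein inequality
`binomMean_variance_le`, and is almost uncorrelated with the mean at `J`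
(`IsRoundsLaw.exists_abs_covariance_le`). So the variance `s` of the number of rounds satisfies
`s = T s + σ + O(1 / n)`, which gives `IsRoundsLaw.exists_variance_asymptotics`. Here `σ` is at
least the variance of the mean at a geometric variable, and positive because the mean is not
constant.

*Distance to the Gaussian.* Let `d n` be the distance `ζ₃` between the centred number of rounds
and the centred Gaussian of the same variance. Conditionally on `(I, J)` the first summand is
replaced by a Gaussian at the cost `d I`. What remains is a Gaussian of variance `s I`, shifted by
a quantity with bounded third moment; its comparison with the Gaussian of variance `s n` by a
Taylor expansion (`exists_gaussian_comparison`) costs `O(1)`, since the terms of first and second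
order average to zero and since `H n - H I` has a bounded third moment
(`binomMean_harmonic_sub_cube_le`). Thus `d ≤ T d + O(1)`, and `d = O(log n)` by the maximum
principle. As `ζ₃` scales with the third power, division by the standard deviation, of order
`√(log n)`, turns this into the rate `1 / √(log n)`. The class of test functions contains
multiples of `cos (t x)` and `sin (t x)`, so the limit law follows from Lévy's continuity theorem.
-/

namespace MaxFinding

open scoped NNReal

/-! ### Binomial averages -/

/-- The mean `E h(B)` of `h` at a binomial variable `B` with parameters `n` and `1 / 2`. -/
noncomputable def binomMean (h : ℕ → ℝ) (n : ℕ) : ℝ :=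
  ∑ j ∈ Finset.range (n + 1), (n.choose j : ℝ) * (1 / 2 : ℝ) ^ n * h j

lemma binomMean_zero (h : ℕ → ℝ) : binomMean h 0 = h 0 := by simp [binomMean]

lemma binomMean_succ (h : ℕ → ℝ) (n : ℕ) :
    binomMean h (n + 1) = (binomMean h n + binomMean (fun j => h (j + 1)) n) / 2 := by
  unfold binomMean
  rw [Finset.sum_range_succ']
  simp only [Nat.choose_succ_succ, Nat.cast_add, add_mul, Finset.sum_add_distrib]
  have h2 : ∑ j ∈ Finset.range (n + 1), (n.choose (j + 1) : ℝ) * (1 / 2 : ℝ) ^ (n + 1) * h (j + 1)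
      + ((n + 1).choose 0 : ℝ) * (1 / 2) ^ (n + 1) * h 0
      = ∑ j ∈ Finset.range (n + 1), (n.choose j : ℝ) * (1 / 2 : ℝ) ^ (n + 1) * h j := by
    rw [Finset.sum_range_succ, Finset.sum_range_succ' _ n]
    simp
  rw [add_assoc, h2, add_comm, add_div, Finset.sum_div, Finset.sum_div]
  congr 1 <;> refine Finset.sum_congr rfl fun j _ => ?_ <;> ring

lemma binomMean_mono {g h : ℕ → ℝ} {n : ℕ} (H : ∀ j ≤ n, g j ≤ h j) :
    binomMean g n ≤ binomMean h n :=
  Finset.sum_le_sum fun j hj => mul_le_mul_of_nonneg_left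
    (H j (by have := Finset.mem_range.1 hj; omega)) (by positivity)

lemma binomMean_add (g h : ℕ → ℝ) (n : ℕ) :
    binomMean (fun j => g j + h j) n = binomMean g n + binomMean h n := by
  simp only [binomMean, mul_add, Finset.sum_add_distrib]

lemma binomMean_sub (g h : ℕ → ℝ) (n : ℕ) :
    binomMean (fun j => g j - h j) n = binomMean g n - binomMean h n := by
  simp only [binomMean, mul_sub, Finset.sum_sub_distrib]

lemma binomMean_const_mul (c : ℝ) (h : ℕ → ℝ) (n : ℕ) :
    binomMean (fun j => c * h j) n = c * binomMean h n := by
  simp only [binomMean, Finset.mul_sum]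
  exact Finset.sum_congr rfl fun j _ => by ring

lemma binomMean_const (c : ℝ) (n : ℕ) : binomMean (fun _ => c) n = c := by
  induction n with
  | zero => simp [binomMean]
  | succ n ih => rw [binomMean_succ, ih]; ring

lemma abs_binomMean_le (h : ℕ → ℝ) (n : ℕ) : |binomMean h n| ≤ binomMean (fun j => |h j|) n := by
  refine (Finset.abs_sum_le_sum_abs _ _).trans (le_of_eq (Finset.sum_congr rfl fun j _ => ?_))
  rw [abs_mul, abs_of_nonneg (by positivity : (0 : ℝ) ≤ (n.choose j : ℝ) * (1 / 2) ^ n)]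

lemma binomMean_sq_le (h : ℕ → ℝ) (n : ℕ) : binomMean h n ^ 2 ≤ binomMean (fun j => h j ^ 2) n := by
  have h1 : 0 ≤ binomMean (fun j => (h j - binomMean h n) ^ 2) n := by
    rw [← binomMean_const 0 n]
    exact binomMean_mono fun j _ => sq_nonneg _
  have h2 : binomMean (fun j => (h j - binomMean h n) ^ 2) n
      = binomMean (fun j => h j ^ 2) n - binomMean h n ^ 2 := by
    rw [show (fun j => (h j - binomMean h n) ^ 2)
      = fun j => (h j ^ 2 - 2 * binomMean h n * h j) + binomMean h n ^ 2 by ext; ring,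
      binomMean_add, binomMean_sub, binomMean_const_mul, binomMean_const]
    ring
  linarith

/-- The Efron–Stein inequality for a function of the number of heads among `n + 1` fair coins. -/
lemma binomMean_variance_le (h : ℕ → ℝ) (n : ℕ) :
    binomMean (fun j => h j ^ 2) (n + 1) - binomMean h (n + 1) ^ 2
      ≤ ((n : ℝ) + 1) / 4 * binomMean (fun j => (h (j + 1) - h j) ^ 2) n := by
  induction n generalizing h with
  | zero => simp only [binomMean_succ, binomMean_zero]; push_cast; nlinarith
  | succ n ih =>
    have h1 := ih h
    have h2 := ih (fun j => h (j + 1))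
    have h3 := binomMean_sq_le (fun j => h (j + 1) - h j) (n + 1)
    rw [binomMean_sub] at h3
    rw [binomMean_succ (fun j => (h (j + 1) - h j) ^ 2) n] at h3 ⊢
    rw [binomMean_succ _ (n + 1), binomMean_succ _ (n + 1)]
    push_cast
    nlinarith

lemma binomMean_pow (c : ℝ) (n : ℕ) : binomMean (fun j => c ^ j) n = ((1 + c) / 2) ^ n := by
  induction n with
  | zero => simp [binomMean]
  | succ n ih =>
    rw [binomMean_succ, ih, show (fun j => c ^ (j + 1)) = fun j => c * c ^ j by ext; ring,
      binomMean_const_mul, ih]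
    ring

lemma binomMean_inv (n : ℕ) :
    binomMean (fun j => 1 / ((j : ℝ) + 1)) n = (2 - (1 / 2 : ℝ) ^ n) / (n + 1) := by
  have h1 : ∀ j, (n.choose j : ℝ) * (1 / ((j : ℝ) + 1))
      = ((n + 1).choose (j + 1) : ℝ) / (n + 1) := by
    intro j
    have := Nat.add_one_mul_choose_eq n j
    have h : ((n : ℝ) + 1) * n.choose j = (n + 1).choose (j + 1) * (j + 1) := by exact_mod_cast this
    field_simp
    linarith
  have h2 : ∑ j ∈ Finset.range (n + 1), ((n + 1).choose (j + 1) : ℝ) = 2 ^ (n + 1) - 1 := by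
    have := Nat.sum_range_choose (n + 1)
    rw [Finset.sum_range_succ'] at this
    have h : (∑ j ∈ Finset.range (n + 1), ((n + 1).choose (j + 1) : ℝ)) + 1 = 2 ^ (n + 1) := by
      exact_mod_cast this
    linarith
  have h3 : binomMean (fun j => 1 / ((j : ℝ) + 1)) n
      = (1 / 2 : ℝ) ^ n / (n + 1) * ∑ j ∈ Finset.range (n + 1), ((n + 1).choose (j + 1) : ℝ) := by
    rw [binomMean, Finset.mul_sum]
    refine Finset.sum_congr rfl fun j _ => ?_
    rw [mul_right_comm, h1]; ring
  rw [h3, h2]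
  have : (1 / 2 : ℝ) ^ n * 2 ^ n = 1 := by rw [← mul_pow]; norm_num
  field_simp
  rw [pow_succ]
  linear_combination 2 * this

lemma binomMean_inv_mul_inv (n : ℕ) :
    binomMean (fun j => 1 / (((j : ℝ) + 1) * (j + 2))) n
      = (4 - (n + 3) * (1 / 2 : ℝ) ^ n) / ((n + 1) * (n + 2)) := by
  have h1 : ∀ j, (n.choose j : ℝ) * (1 / (((j : ℝ) + 1) * (j + 2)))
      = ((n + 2).choose (j + 2) : ℝ) / ((n + 1) * (n + 2)) := by
    intro j
    have h : ((n : ℝ) + 1) * n.choose j = (n + 1).choose (j + 1) * (j + 1) := by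
      exact_mod_cast Nat.add_one_mul_choose_eq n j
    have h' : ((n : ℝ) + 2) * (n + 1).choose (j + 1) = (n + 2).choose (j + 2) * (j + 2) := by
      exact_mod_cast Nat.add_one_mul_choose_eq (n + 1) (j + 1)
    field_simp
    linear_combination ((n : ℝ) + 2) * h + ((j : ℝ) + 1) * h'
  have h2 : ∑ j ∈ Finset.range (n + 1), ((n + 2).choose (j + 2) : ℝ) = 2 ^ (n + 2) - (n + 3) := by
    have := Nat.sum_range_choose (n + 2)
    rw [Finset.sum_range_succ', Finset.sum_range_succ'] at this
    have h : (∑ j ∈ Finset.range (n + 1), ((n + 2).choose (j + 2) : ℝ)) + (n + 2) + 1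
        = 2 ^ (n + 2) := by
      have := congrArg (Nat.cast : ℕ → ℝ) this
      push_cast at this
      simpa using this
    linarith
  have h3 : binomMean (fun j => 1 / (((j : ℝ) + 1) * (j + 2))) n
      = (1 / 2 : ℝ) ^ n / ((n + 1) * (n + 2))
        * ∑ j ∈ Finset.range (n + 1), ((n + 2).choose (j + 2) : ℝ) := by
    rw [binomMean, Finset.mul_sum]
    refine Finset.sum_congr rfl fun j _ => ?_
    rw [mul_right_comm, h1]; ring
  rw [h3, h2]
  have : (1 / 2 : ℝ) ^ n * 2 ^ n = 1 := by rw [← mul_pow]; norm_num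
  field_simp
  rw [pow_add]
  linear_combination 4 * this

/-! ### The harmonic numbers under binomial averages -/

/-- The constant `∑ k, 2⁻⁽ᵏ⁺¹⁾ / (k + 1)`, which equals `log 2`; the mean of the harmonic number
`H_B` for a binomial variable `B` is `H_n` minus this constant, up to an exponentially small
term. -/
noncomputable def harmonicDrift : ℝ := ∑' k : ℕ, (1 / 2 : ℝ) ^ (k + 1) / (k + 1)

lemma summable_half_pow_div : Summable fun k : ℕ => (1 / 2 : ℝ) ^ (k + 1) / (k + 1) := by
  refine Summable.of_nonneg_of_le (fun k => by positivity) (fun k => ?_)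
    (summable_geometric_two)
  rw [pow_succ]
  apply div_le_of_le_mul₀ (by positivity) (by positivity)
  have : (0 : ℝ) ≤ (1 / 2) ^ k := by positivity
  nlinarith [(Nat.cast_nonneg k : (0 : ℝ) ≤ k)]

lemma binomMean_harmonic (n : ℕ) : binomMean (fun j => (harmonic j : ℝ)) n
    = harmonic n - ∑ k ∈ Finset.range n, (1 / 2 : ℝ) ^ (k + 1) / (k + 1) := by
  induction n with
  | zero => simp [binomMean]
  | succ n ih =>
    have : (fun j : ℕ => (harmonic (j + 1) : ℝ))
        = fun j => (harmonic j : ℝ) + 1 / ((j : ℝ) + 1) := by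
      ext j; rw [harmonic_succ]; push_cast; ring
    rw [binomMean_succ, this, binomMean_add, ih, binomMean_inv, Finset.sum_range_succ,
        harmonic_succ]
    push_cast
    field_simp
    ring

lemma half_le_harmonicDrift : 1 / 2 ≤ harmonicDrift := by
  have := summable_half_pow_div.sum_le_tsum (Finset.range 1) (fun k _ => by positivity)
  simpa [harmonicDrift] using this

lemma abs_binomMean_harmonic_sub (n : ℕ) :
    |binomMean (fun j => (harmonic j : ℝ)) n - (harmonic n - harmonicDrift)|
        ≤ 1 / ((n : ℝ) + 1) := by
  have h0 := summable_half_pow_div.sum_add_tsum_nat_add n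
  have h1 : Summable fun k : ℕ => (1 / 2 : ℝ) ^ (k + n + 1) / ((k + n : ℕ) + 1) :=
    (summable_nat_add_iff n).2 summable_half_pow_div
  have h2 : ∑' k : ℕ, (1 / 2 : ℝ) ^ (k + n + 1) / ((k + n : ℕ) + 1)
      ≤ ∑' k : ℕ, (1 / ((n : ℝ) + 1)) * ((1 / 2) / 2 ^ k) := by
    refine h1.tsum_le_tsum (fun k => ?_) ((summable_geometric_two' _).mul_left _)
    rw [pow_succ, pow_add, one_div_pow 2 k]
    push_cast
    have ha : (1 / 2 : ℝ) ^ n ≤ 1 := pow_le_one₀ (by norm_num) (by norm_num)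
    have hb : 1 / ((k : ℝ) + n + 1) ≤ 1 / ((n : ℝ) + 1) := by
      apply one_div_le_one_div_of_le (by positivity)
      linarith [(Nat.cast_nonneg k : (0 : ℝ) ≤ k)]
    calc 1 / (2 : ℝ) ^ k * (1 / 2) ^ n * (1 / 2) / (k + n + 1)
        = (1 / 2) ^ n * (1 / ((k : ℝ) + n + 1)) * (1 / 2 / 2 ^ k) := by ring
      _ ≤ 1 * (1 / ((n : ℝ) + 1)) * (1 / 2 / 2 ^ k) := by gcongr
      _ = _ := by ring
  have h3 : ∑' k : ℕ, ((1 : ℝ) / 2) / 2 ^ k = 1 := tsum_geometric_two' 1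
  rw [tsum_mul_left, h3] at h2
  have h4 : 0 ≤ ∑' k : ℕ, (1 / 2 : ℝ) ^ (k + n + 1) / ((k + n : ℕ) + 1) :=
    tsum_nonneg fun k => by positivity
  rw [binomMean_harmonic, harmonicDrift, ← h0, abs_of_nonneg (by linarith)]
  linarith

lemma binomMean_harmonic_le {n : ℕ} (hn : 1 ≤ n) :
    binomMean (fun j => (harmonic j : ℝ)) n ≤ harmonic n - 1 / 2 := by
  rw [binomMean_harmonic]
  have := Finset.sum_le_sum_of_subset_of_nonneg (f := fun k : ℕ => (1 / 2 : ℝ) ^ (k + 1) / (k + 1))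
    (Finset.range_mono hn) (fun k _ _ => by positivity)
  simp only [Finset.sum_range_one] at this
  norm_num at this ⊢
  linarith

lemma harmonic_mono : Monotone fun n : ℕ => (harmonic n : ℝ) :=
  monotone_nat_of_le_succ fun n => by
    have : (0 : ℝ) ≤ ((n : ℝ) + 1)⁻¹ := by positivity
    rw [harmonic_succ]
    push_cast
    linarith

/-- The third moment of `H_n - H_B` is bounded uniformly in `n`: by `1 + log y ≤ 3 y ^ (1 / 3)` it
is controlled by the mean of `(n + 1) / (B + 1)`. -/
lemma binomMean_harmonic_sub_cube_le (n : ℕ) :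
    binomMean (fun j => |(harmonic n : ℝ) - harmonic j| ^ 3) n ≤ 54 := by
  have h1 : ∀ j ≤ n, |(harmonic n : ℝ) - harmonic j| ^ 3 ≤ 27 * (n + 1) * (1 / ((j : ℝ) + 1)) := by
    intro j hj
    have hmono : (harmonic j : ℝ) ≤ harmonic n := harmonic_mono hj
    rw [abs_of_nonneg (by linarith)]
    set y : ℝ := ((n : ℝ) + 1) / (j + 1) with hy
    have hy0 : 0 < y := by positivity
    have hb : (harmonic n : ℝ) - harmonic j ≤ 3 * y ^ (1 / 3 : ℝ) := by
      have h1 : (harmonic n : ℝ) ≤ 1 + Real.log ((n : ℝ) + 1) := by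
        have := harmonic_le_one_add_log (n + 1)
        push_cast at this
        exact (harmonic_mono (Nat.le_succ n)).trans this
      have h2 : Real.log ((j : ℝ) + 1) ≤ harmonic j := by
        have := log_add_one_le_harmonic j
        push_cast at this
        exact this
      have h3 : Real.log y = Real.log ((n : ℝ) + 1) - Real.log ((j : ℝ) + 1) :=
        Real.log_div (by positivity) (by positivity)
      have h4 : Real.log y = 3 * Real.log (y ^ (1 / 3 : ℝ)) := by
        rw [Real.log_rpow hy0]; ring
      have h5 := Real.log_le_sub_one_of_pos (Real.rpow_pos_of_pos hy0 (1 / 3))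
      linarith
    calc ((harmonic n : ℝ) - harmonic j) ^ 3 ≤ (3 * y ^ (1 / 3 : ℝ)) ^ 3 :=
          pow_le_pow_left₀ (by linarith) hb 3
      _ = 27 * y := by
          rw [mul_pow, ← Real.rpow_natCast (y ^ (1 / 3 : ℝ)), ← Real.rpow_mul hy0.le]; norm_num
      _ = _ := by rw [hy]; ring
  refine (binomMean_mono h1).trans ?_
  rw [binomMean_const_mul, binomMean_inv]
  have : (0 : ℝ) ≤ (1 / 2) ^ n := by positivity
  rw [mul_assoc, mul_div_cancel₀ _ (by positivity)]
  linarith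

/-! ### Comparison principle for binomial recurrences -/

/-- A maximum principle: a subsolution of `x = θ T x + ε`, where `T` is the binomial average, stays
below a supersolution, if it does so at the first few indices. -/
lemma le_of_binomMean_le {θ : ℝ} (hθ : 0 ≤ θ) {x w ε : ℕ → ℝ} {n₀ : ℕ}
    (hn₀ : θ * (1 / 2 : ℝ) ^ n₀ < 1) (h0 : ∀ j < n₀, x j ≤ w j)
    (hx : ∀ n ≥ n₀, x n ≤ θ * binomMean x n + ε n)
    (hw : ∀ n ≥ n₀, θ * binomMean w n + ε n ≤ w n) (n : ℕ) : x n ≤ w n := by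
  induction n using Nat.strong_induction_on with
  | _ n ih =>
    rcases lt_or_ge n n₀ with hn | hn
    · exact h0 n hn
    by_contra! hlt
    have h1 : binomMean x n - binomMean w n ≤ (1 / 2 : ℝ) ^ n * (x n - w n) := by
      rw [← binomMean_sub, binomMean, Finset.sum_range_succ]
      have : ∑ j ∈ Finset.range n, (n.choose j : ℝ) * (1 / 2 : ℝ) ^ n * (x j - w j) ≤ 0 :=
        Finset.sum_nonpos fun j hj => mul_nonpos_of_nonneg_of_nonpos (by positivity)
          (by linarith [ih j (Finset.mem_range.1 hj)])
      simp only [Nat.choose_self, Nat.cast_one, one_mul]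
      linarith
    have h2 : (1 / 2 : ℝ) ^ n ≤ (1 / 2 : ℝ) ^ n₀ :=
        pow_le_pow_of_le_one (by norm_num) (by norm_num) hn
    have h3 := hx n hn
    have h4 := hw n hn
    have h5 : θ * (binomMean x n - binomMean w n) ≤ θ * ((1 / 2 : ℝ) ^ n₀ * (x n - w n)) :=
      mul_le_mul_of_nonneg_left (h1.trans (mul_le_mul_of_nonneg_right h2 (by linarith))) hθ
    nlinarith

lemma half_pow_le_quarter {n : ℕ} (hn : 2 ≤ n) : (1 / 2 : ℝ) ^ n ≤ 1 / 4 :=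
  (pow_le_pow_of_le_one (by norm_num) (by norm_num) hn).trans (by norm_num)

/-- The barrier `M - A / (n + 1)` bounds `x` when `x ≤ T x + O(1 / n)`. -/
lemma le_const_of_le_binomMean {x : ℕ → ℝ} {K : ℝ} (hK : 0 ≤ K)
    (hx : ∀ n ≥ 2, x n ≤ binomMean x n + K / ((n : ℝ) + 1)) : ∃ M, ∀ n, x n ≤ M := by
  set M := |x 0| + |x 1| + 2 * K with hM
  have key : ∀ n, x n ≤ M - 2 * K * (1 / ((n : ℝ) + 1)) := by
    refine le_of_binomMean_le (θ := 1) (n₀ := 2) zero_le_one (by norm_num)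
      (ε := fun n => K / ((n : ℝ) + 1)) ?_ (fun n hn => by simpa using hx n hn) ?_
    · intro j hj
      have h0 := le_abs_self (x 0)
      have h1 := le_abs_self (x 1)
      have h0' := abs_nonneg (x 0)
      have h1' := abs_nonneg (x 1)
      interval_cases j <;> norm_num <;> linarith
    · intro n hn
      rw [binomMean_sub, binomMean_const, binomMean_const_mul, binomMean_inv]
      have h1 := half_pow_le_quarter hn
      have h2 : 0 ≤ K * (1 - 2 * (1 / 2 : ℝ) ^ n) := mul_nonneg hK (by linarith)
      have h3 : M - 2 * K * (1 / ((n : ℝ) + 1))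
          - (1 * (M - 2 * K * ((2 - (1 / 2 : ℝ) ^ n) / (n + 1))) + K / ((n : ℝ) + 1))
          = K * (1 - 2 * (1 / 2 : ℝ) ^ n) / (n + 1) := by field_simp; ring
      have h4 : 0 ≤ K * (1 - 2 * (1 / 2 : ℝ) ^ n) / ((n : ℝ) + 1) := by positivity
      linarith
  refine ⟨M, fun n => (key n).trans ?_⟩
  have : 0 ≤ 2 * K * (1 / ((n : ℝ) + 1)) := by positivity
  linarith

/-- Solutions of `x = T x + σ + O(1 / n)` grow like a multiple of the harmonic numbers. -/
lemma abs_sub_harmonic_le_of_binomMean {x : ℕ → ℝ} {σ K : ℝ}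
    (hx : ∀ n ≥ 2, |x n - binomMean x n - σ| ≤ K / ((n : ℝ) + 1)) :
    ∃ M, ∀ n, |x n - σ / harmonicDrift * harmonic n| ≤ M := by
  have hL := half_le_harmonicDrift
  have hK : 0 ≤ K := by
    have h := (abs_nonneg _).trans (hx 2 le_rfl)
    by_contra! hc
    have : K / ((2 : ℕ) + 1 : ℝ) < 0 := div_neg_of_neg_of_pos hc (by norm_num)
    linarith
  set a := σ / harmonicDrift with ha
  set D : ℕ → ℝ := fun n => x n - a * harmonic n with hD
  have hbound : ∀ n ≥ 2, |D n - binomMean D n| ≤ (K + |a|) / ((n : ℝ) + 1) := by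
    intro n hn
    have h1 := hx n hn
    have h2 := abs_binomMean_harmonic_sub n
    have h3 : D n - binomMean D n = (x n - binomMean x n - σ)
        + a * (binomMean (fun j => (harmonic j : ℝ)) n - (harmonic n - harmonicDrift)) := by
      have : a * harmonicDrift = σ := div_mul_cancel₀ _ (by linarith)
      simp only [hD, binomMean_sub, binomMean_const_mul]
      linear_combination -this
    rw [h3]
    refine (abs_add_le _ _).trans ?_
    rw [abs_mul, add_div]
    have := mul_le_mul_of_nonneg_left h2 (abs_nonneg a)
    rw [mul_one_div] at this
    linarith
  obtain ⟨M₁, h₁⟩ := le_const_of_le_binomMean (x := D) (K := K + |a|) (by positivity)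
    (fun n hn => by linarith [(abs_le.1 (hbound n hn)).2])
  obtain ⟨M₂, h₂⟩ := le_const_of_le_binomMean (x := fun n => -1 * D n) (K :=
      K + |a|) (by positivity)
    (fun n hn => by rw [binomMean_const_mul]; linarith [(abs_le.1 (hbound n hn)).1])
  refine ⟨max M₁ M₂, fun n => abs_le.2 ⟨?_, ?_⟩⟩
  · have := h₂ n
    have := le_max_right M₁ M₂
    simp only [hD] at *
    linarith
  · exact (h₁ n).trans (le_max_left _ _)

lemma le_inv_of_le_half_binomMean {x : ℕ → ℝ} {K : ℝ} (hK : 0 ≤ K)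
    (hx : ∀ n ≥ 2, x n ≤ 1 / 2 * binomMean x n + K / (((n : ℝ) + 1) * (n + 2))) :
    ∃ A, 0 ≤ A ∧ ∀ n, x n ≤ A / ((n : ℝ) + 1) := by
  set A := |x 0| + 2 * |x 1| + 3 * K with hA
  have key : ∀ n, x n ≤ A * (1 / ((n : ℝ) + 1)) - 3 * K * (1 / (((n : ℝ) + 1) * (n + 2))) := by
    refine le_of_binomMean_le (θ := 1 / 2) (n₀ := 2) (by norm_num) (by norm_num)
      (ε := fun n => K / (((n : ℝ) + 1) * (n + 2))) ?_ (fun n hn => hx n hn) ?_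
    · intro j hj
      have h0 := le_abs_self (x 0)
      have h1 := le_abs_self (x 1)
      have h0' := abs_nonneg (x 0)
      have h1' := abs_nonneg (x 1)
      interval_cases j <;> norm_num <;> linarith
    · intro n hn
      rw [binomMean_sub, binomMean_const_mul, binomMean_const_mul, binomMean_inv,
        binomMean_inv_mul_inv]
      have h1 : ((n : ℝ) + 3) * (1 / 2 : ℝ) ^ n ≤ 5 / 4 := by
        induction n, hn using Nat.le_induction with
        | base => norm_num
        | succ m hm ih =>
          have : 0 ≤ (1 / 2 : ℝ) ^ m := by positivity
          rw [pow_succ]; push_cast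
          nlinarith [(Nat.cast_nonneg m : (0 : ℝ) ≤ m)]
      have h2 : 0 ≤ K * (1 / 2 - 3 / 8) := mul_nonneg hK (by norm_num)
      have h3 : A * (1 / ((n : ℝ) + 1)) - 3 * K * (1 / (((n : ℝ) + 1) * (n + 2)))
          - (1 / 2 * (A * ((2 - (1 / 2 : ℝ) ^ n) / (n + 1))
            - 3 * K * ((4 - (n + 3) * (1 / 2 : ℝ) ^ n) / ((n + 1) * (n + 2))))
            + K / (((n : ℝ) + 1) * (n + 2)))
          = A * (1 / 2) ^ n / 2 / (n + 1)
            + K * (2 - 3 / 2 * ((n + 3) * (1 / 2 : ℝ) ^ n)) / ((n + 1) * (n + 2)) := by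
        field_simp; ring
      have h4 : 0 ≤ K * (2 - 3 / 2 * (((n : ℝ) + 3) * (1 / 2 : ℝ) ^ n)) :=
        mul_nonneg hK (by linarith)
      have h5 : 0 ≤ A * (1 / 2) ^ n / 2 / ((n : ℝ) + 1)
            + K * (2 - 3 / 2 * ((n + 3) * (1 / 2 : ℝ) ^ n)) / ((n + 1) * (n + 2)) := by
        positivity
      linarith
  refine ⟨A, by positivity, fun n => (key n).trans ?_⟩
  have : 0 ≤ 3 * K * (1 / (((n : ℝ) + 1) * (n + 2))) := by positivity
  rw [mul_one_div]
  linarith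

/-- Solutions of `x = T x / 2 + O(1 / n²)` are `O(1 / n)`. -/
lemma abs_le_inv_of_half_binomMean {x : ℕ → ℝ} {K : ℝ}
    (hx : ∀ n ≥ 2, |x n - 1 / 2 * binomMean x n| ≤ K / (((n : ℝ) + 1) * (n + 2))) :
    ∃ A, 0 ≤ A ∧ ∀ n, |x n| ≤ A / ((n : ℝ) + 1) := by
  have hK : 0 ≤ K := by
    have h := (abs_nonneg _).trans (hx 2 le_rfl)
    by_contra! hc
    have : K / (((2 : ℕ) + 1 : ℝ) * ((2 : ℕ) + 2)) < 0 := div_neg_of_neg_of_pos hc (by norm_num)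
    linarith
  obtain ⟨A₁, h₁, h₁'⟩ := le_inv_of_le_half_binomMean (x := x) hK
    (fun n hn => by linarith [(abs_le.1 (hx n hn)).2])
  obtain ⟨A₂, h₂, h₂'⟩ := le_inv_of_le_half_binomMean (x := fun n => -1 * x n) hK
    (fun n hn => by rw [binomMean_const_mul]; linarith [(abs_le.1 (hx n hn)).1])
  refine ⟨max A₁ A₂, le_max_of_le_left h₁, fun n => abs_le.2 ⟨?_, ?_⟩⟩
  · have h3 := h₂' n
    have : A₂ / ((n : ℝ) + 1) ≤ max A₁ A₂ / ((n : ℝ) + 1) := by gcongr; exact le_max_right _ _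
    linarith
  · refine (h₁' n).trans ?_
    gcongr
    exact le_max_left _ _

/-! ### Averages over the pair of subproblem sizes -/

/-- The mean `E F(I, J)` for a pair `(I, J)` with law `splitProb n`. -/
noncomputable def splitMean (n : ℕ) (F : ℕ → ℕ → ℝ) : ℝ :=
  ∑ j ∈ Finset.range (n + 1), ∑ k ∈ Finset.range (n + 1), splitProb n j k * F j k

/-- The mean of `g` at the second component of the pair of subproblem sizes, a truncated geometric
variable. -/
noncomputable def geomMean (g : ℕ → ℝ) (n : ℕ) : ℝ :=
  (1 / 2 : ℝ) ^ n * g 0 + ∑ k ∈ Finset.range n, (1 / 2 : ℝ) ^ (k + 1) * g k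

/-- Conditionally on the second component being `k` (and on at least one of the two components being
positive), the first one is `1` plus a binomial variable with parameters `n - 1 - k` and `1 / 2`. -/
lemma splitMean_eq (n : ℕ) (F : ℕ → ℕ → ℝ) : splitMean n F = (1 / 2 : ℝ) ^ n * F 0 0
    + ∑ k ∈ Finset.range n, (1 / 2 : ℝ) ^ (k + 1)
      * binomMean (fun i => F (i + 1) k) (n - 1 - k) := by
  rw [splitMean, Finset.sum_range_succ', add_comm]
  congr 1
  · rw [Finset.sum_range_succ']
    rw [Finset.sum_eq_zero fun k _ => by rw [Existence.splitProb_zero_right _ _ (by omega),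
        zero_mul]]
    simp [splitProb]
  · rw [Finset.sum_comm, Finset.sum_range_succ, add_eq_left.2]
    · refine Finset.sum_congr rfl fun k hk => ?_
      have hk := Finset.mem_range.1 hk
      obtain ⟨m, rfl⟩ : ∃ m, n = m + 1 + k := ⟨n - k - 1, by omega⟩
      rw [Finset.sum_range_add _ (m + 1) k, Finset.sum_eq_zero (s := Finset.range k), add_zero,
        binomMean, show m + 1 + k - 1 - k = m by omega, Finset.mul_sum]
      · refine Finset.sum_congr rfl fun j hj => ?_
        have := Finset.mem_range.1 hj
        rw [splitProb, if_neg (by omega), if_pos (by omega),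
          show m + 1 + k - k - 1 = m by omega, show m + 1 + k = m + (k + 1) by omega, pow_add]
        simp only [Nat.add_sub_cancel]
        ring
      · intro x _
        rw [splitProb, if_neg (by omega), if_neg (by omega), zero_mul]
    · refine Finset.sum_eq_zero fun x _ => ?_
      rw [splitProb, if_neg (by omega), if_neg (by omega), zero_mul]

lemma splitMean_left (n : ℕ) (h : ℕ → ℝ) : splitMean n (fun j _ => h j) = binomMean h n := by
  rw [splitMean_eq]
  induction n with
  | zero => simp [binomMean]
  | succ n ih =>
    rw [binomMean_succ, ← ih, Finset.sum_range_succ']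
    simp only [pow_succ, show ∀ k, n + 1 - 1 - (k + 1) = n - 1 - k by intro k; omega]
    simp only [mul_assoc, add_div, Finset.sum_div, pow_zero, one_mul, Nat.add_sub_cancel,
      Nat.sub_zero]
    rw [show ∀ a b c : ℝ, a + (b + c) = a + b + c by intros; ring]
    congr 1
    · congr 1
      · ring
      · exact Finset.sum_congr rfl fun k _ => by ring
    · ring

lemma splitMean_right (n : ℕ) (g : ℕ → ℝ) : splitMean n (fun _ k => g k) = geomMean g n := by
  rw [splitMean_eq, geomMean]
  simp_rw [binomMean_const]

lemma splitMean_mono {n : ℕ} {F G : ℕ → ℕ → ℝ} (h : ∀ j ≤ n, ∀ k ≤ n, F j k ≤ G j k) :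
    splitMean n F ≤ splitMean n G :=
  Finset.sum_le_sum fun j hj => Finset.sum_le_sum fun k hk => mul_le_mul_of_nonneg_left
    (h j (by have := Finset.mem_range.1 hj; omega) k (by have := Finset.mem_range.1 hk; omega))
    (Existence.splitProb_nonneg n j k)

lemma splitMean_congr {n : ℕ} {F G : ℕ → ℕ → ℝ} (h : ∀ j ≤ n, ∀ k ≤ n, F j k = G j k) :
    splitMean n F = splitMean n G :=
  le_antisymm (splitMean_mono fun j hj k hk => (h j hj k hk).le)
    (splitMean_mono fun j hj k hk => (h j hj k hk).ge)

lemma splitMean_add (n : ℕ) (F G : ℕ → ℕ → ℝ) :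
    splitMean n (fun j k => F j k + G j k) = splitMean n F + splitMean n G := by
  simp only [splitMean, mul_add, Finset.sum_add_distrib]

lemma splitMean_sub (n : ℕ) (F G : ℕ → ℕ → ℝ) :
    splitMean n (fun j k => F j k - G j k) = splitMean n F - splitMean n G := by
  simp only [splitMean, mul_sub, Finset.sum_sub_distrib]

lemma splitMean_const_mul (n : ℕ) (c : ℝ) (F : ℕ → ℕ → ℝ) :
    splitMean n (fun j k => c * F j k) = c * splitMean n F := by
  simp only [splitMean, Finset.mul_sum]
  exact Finset.sum_congr rfl fun j _ => Finset.sum_congr rfl fun k _ => by ring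

lemma splitMean_const (n : ℕ) (c : ℝ) : splitMean n (fun _ _ => c) = c := by
  rw [splitMean_left n (fun _ => c), binomMean_const]

lemma abs_splitMean_le (n : ℕ) (F : ℕ → ℕ → ℝ) :
    |splitMean n F| ≤ splitMean n (fun j k => |F j k|) := by
  refine (Finset.abs_sum_le_sum_abs _ _).trans (Finset.sum_le_sum fun j _ => ?_)
  refine (Finset.abs_sum_le_sum_abs _ _).trans (le_of_eq (Finset.sum_congr rfl fun k _ => ?_))
  rw [abs_mul, abs_of_nonneg (Existence.splitProb_nonneg n j k)]

/-! ### The recurrence for the laws -/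

/-- The laws `ν n` of the number of rounds with `n` processors: probability measures with
`ν 0 = ν 1 = δ₁`, which satisfy the distributional recurrence of Algorithm A. -/
structure IsRoundsLaw (ν : ℕ → Measure ℝ) : Prop where
  prob : ∀ n, IsProbabilityMeasure (ν n)
  zero : ν 0 = Measure.dirac 1
  one : ν 1 = Measure.dirac 1
  recurrence : ∀ n, 2 ≤ n → ν n = ∑ p ∈ Finset.range (n + 1) ×ˢ Finset.range (n + 1),
      ENNReal.ofReal (splitProb n p.1 p.2) • Existence.step ν p

theorem IsRounds.isRoundsLaw {Ω : Type*} [MeasurableSpace Ω] {P : Measure Ω}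
    [IsProbabilityMeasure P] {Y : ℕ → Ω → ℝ} (hY : IsRounds P Y) :
    IsRoundsLaw (fun n => P.map (Y n)) where
  prob n := Measure.isProbabilityMeasure_map (hY.aemeasurable n)
  zero := by
    rw [Measure.map_congr (g := fun _ => (1 : ℝ)) hY.zero]
    simp
  one := by
    rw [Measure.map_congr (g := fun _ => (1 : ℝ)) hY.one]
    simp
  recurrence n hn := by
    obtain ⟨Ω', _, P', hP', V, W, I, J, hV, hW, hI, hJ, hVY, hWY, hIJ, hind, hind', hid⟩ :=
      hY.recurrence n hn
    set ν : ℕ → Measure ℝ := fun n => P.map (Y n)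
    have hν : ∀ k, IsProbabilityMeasure (ν k) :=
      fun k => Measure.isProbabilityMeasure_map (hY.aemeasurable k)
    have hIJm : Measurable fun ω => (I ω, J ω) := hI.prodMk hJ
    set lam := P'.map fun ω => (I ω, J ω) with hlam
    have hlamP : IsProbabilityMeasure lam := Measure.isProbabilityMeasure_map hIJm.aemeasurable
    have hlam1 : ∀ p : ℕ × ℕ, lam {p} = ENNReal.ofReal (splitProb n p.1 p.2) := by
      rintro ⟨j, k⟩
      rw [hlam, Measure.map_apply hIJm (measurableSet_singleton _), ← hIJ j k, ofReal_measureReal]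
      congr 1
      ext ω; simp
    have hjoint : ∀ j k, P'.map (fun ω => (V j ω, (W k ω, (I ω, J ω))))
        = (ν j).prod ((ν k).prod lam) := by
      intro j k
      have h1 : IndepFun (V j) (fun ω => (W k ω, (I ω, J ω))) P' :=
        hind.comp (φ := fun v : ℕ → ℝ => v j)
          (ψ := fun w : (ℕ → ℝ) × (ℕ × ℕ) => (w.1 k, w.2)) (by fun_prop) (by fun_prop)
      have h2 : IndepFun (W k) (fun ω => (I ω, J ω)) P' :=
        hind'.comp (φ := fun v : ℕ → ℝ => v k) (ψ := id) (by fun_prop) measurable_id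
      rw [(indepFun_iff_map_prod_eq_prod_map_map (hV j).aemeasurable
        ((hW k).prodMk hIJm).aemeasurable).1 h1,
        (indepFun_iff_map_prod_eq_prod_map_map (hW k).aemeasurable hIJm.aemeasurable).1 h2,
        (hVY j).map_eq, (hWY k).map_eq]
    change P.map (Y n) = _
    rw [hid.map_eq]
    have hF : Measurable fun ω => V (I ω) ω + W (J ω) ω + 1 := by
      have h1 : ∀ {U : ℕ → Ω' → ℝ} {N : Ω' → ℕ}, (∀ k, Measurable (U k)) → Measurable N →
          Measurable fun ω => U (N ω) ω := by
        intro U N hU hN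
        have : Measurable fun q : ℕ × Ω' => U q.1 q.2 := measurable_from_prod_countable_right hU
        exact this.comp (hN.prodMk measurable_id)
      exact ((h1 hV hI).add (h1 hW hJ)).add_const 1
    ext s hs
    have hpre : ∀ p : ℕ × ℕ, P' ((fun ω => V (I ω) ω + W (J ω) ω + 1) ⁻¹' s
        ∩ (fun ω => (I ω, J ω)) ⁻¹' {p})
        = ENNReal.ofReal (splitProb n p.1 p.2) * Existence.step ν p s := by
      rintro ⟨j, k⟩
      have hset : MeasurableSet {q : ℝ × (ℝ × (ℕ × ℕ)) | q.1 + q.2.1 + 1 ∈ s ∧ q.2.2 = (j, k)} := by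
        apply MeasurableSet.inter
        · exact (by fun_prop : Measurable fun q : ℝ × (ℝ × (ℕ × ℕ)) => q.1 + q.2.1 + 1) hs
        · exact (by fun_prop : Measurable fun q : ℝ × (ℝ × (ℕ × ℕ)) => q.2.2)
            (measurableSet_singleton _)
      have h1 : (fun ω => V (I ω) ω + W (J ω) ω + 1) ⁻¹' s ∩ (fun ω => (I ω, J ω)) ⁻¹' {(j, k)}
          = (fun ω => (V j ω, (W k ω, (I ω, J ω)))) ⁻¹'
            {q : ℝ × (ℝ × (ℕ × ℕ)) | q.1 + q.2.1 + 1 ∈ s ∧ q.2.2 = (j, k)} := by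
        ext ω
        simp only [Set.mem_inter_iff, Set.mem_preimage, Set.mem_singleton_iff, Prod.mk.injEq,
          Set.mem_ofPred_eq]
        constructor <;> rintro ⟨h, rfl, rfl⟩ <;> exact ⟨h, rfl, rfl⟩
      rw [h1, ← Measure.map_apply ((hV j).prodMk ((hW k).prodMk hIJm)) hset, hjoint,
        Measure.prod_apply hset, Existence.step, Measure.map_apply (by fun_prop) hs,
        Measure.prod_apply ((by fun_prop : Measurable fun x : ℝ × ℝ => x.1 + x.2 + 1) hs), ← hlam1,
        ← lintegral_const_mul _ (measurable_measure_prodMk_left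
          ((by fun_prop : Measurable fun x : ℝ × ℝ => x.1 + x.2 + 1) hs))]
      refine lintegral_congr fun x => ?_
      rw [mul_comm, ← Measure.prod_prod]
      rfl
    have hsum : P' ((fun ω => V (I ω) ω + W (J ω) ω + 1) ⁻¹' s)
        = ∑' p : ℕ × ℕ, ENNReal.ofReal (splitProb n p.1 p.2) * Existence.step ν p s := by
      simp_rw [← hpre]
      rw [← measure_iUnion]
      · congr 1
        ext ω; simp
      · intro p q hpq
        refine Set.disjoint_left.2 fun ω h1 h2 => hpq ?_
        exact h1.2.symm.trans h2.2
      · exact fun p => (hF hs).inter (hIJm (measurableSet_singleton p))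
    rw [Measure.map_apply hF hs, hsum]
    simp only [Measure.coe_finsetSum, Finset.sum_apply, Measure.smul_apply, smul_eq_mul]
    refine tsum_eq_sum fun p hp => ?_
    rw [Existence.splitProb_eq_zero, ENNReal.ofReal_zero, zero_mul]
    simp at hp
    omega

/-! ### Third moments -/

/-- Continuous functions of at most cubic growth, which are integrable with respect to finite
measures with a third absolute moment. -/
structure CubicGrowth (g : ℝ → ℝ) : Prop where
  continuous : Continuous g
  bound : ∃ A, ∀ x, |g x| ≤ A * (1 + |x| ^ 3)

lemma abs_add_add_cube_le (x y z : ℝ) : |x + y + z| ^ 3 ≤ 9 * (|x| ^ 3 + |y| ^ 3 + |z| ^ 3) := by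
  have h : |x + y + z| ^ 3 ≤ (|x| + |y| + |z|) ^ 3 :=
    pow_le_pow_left₀ (abs_nonneg _) ((abs_add_le _ _).trans (by gcongr; exact abs_add_le _ _)) 3
  have hx := abs_nonneg x
  have hy := abs_nonneg y
  have hz := abs_nonneg z
  generalize |x| = a at *
  generalize |y| = b at *
  generalize |z| = c at *
  nlinarith [mul_nonneg (add_nonneg hx hy) (sq_nonneg (a - b)),
    mul_nonneg (add_nonneg hx hz) (sq_nonneg (a - c)),
    mul_nonneg (add_nonneg hy hz) (sq_nonneg (b - c)),
    mul_nonneg hx (sq_nonneg (b - c)), mul_nonneg hy (sq_nonneg (a - c)),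
    mul_nonneg hz (sq_nonneg (a - b))]

lemma CubicGrowth.integrable {g : ℝ → ℝ} (hg : CubicGrowth g) {μ : Measure ℝ} [IsFiniteMeasure μ]
    (hμ : Integrable (fun x => |x| ^ 3) μ) : Integrable g μ := by
  obtain ⟨A, hA⟩ := hg.bound
  refine Integrable.mono' (g := fun x => A * (1 + |x| ^ 3))
      (((integrable_const 1).add hμ).const_mul A)
    hg.continuous.aestronglyMeasurable (ae_of_all _ fun x => ?_)
  exact hA x

lemma cubicGrowth_abs_cube : CubicGrowth fun x => |x| ^ 3 :=
  ⟨by fun_prop, 1, fun x => by rw [abs_of_nonneg (by positivity)]; linarith [abs_nonneg x]⟩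

lemma CubicGrowth.integrable_prod {g : ℝ → ℝ} (hg : CubicGrowth g) {μ ν : Measure ℝ}
    [IsFiniteMeasure μ] [IsFiniteMeasure ν] (hμ : Integrable (fun x => |x| ^ 3) μ)
    (hν : Integrable (fun x => |x| ^ 3) ν) (c : ℝ) :
    Integrable (fun p : ℝ × ℝ => g (p.1 + p.2 + c)) (μ.prod ν) := by
  obtain ⟨A, hA⟩ := hg.bound
  have hA0 : 0 ≤ A := by
    have := (abs_nonneg _).trans (hA 0)
    simpa using this
  have h1 : Integrable (fun p : ℝ × ℝ => A * (1 + 9 * (|p.1| ^ 3 + |p.2| ^ 3 + |c| ^ 3)))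
      (μ.prod ν) :=
    ((integrable_const 1).add ((((hμ.comp_fst ν).add (hν.comp_snd μ)).add
      (integrable_const _)).const_mul 9)).const_mul A
  refine h1.mono' (hg.continuous.comp (by fun_prop)).aestronglyMeasurable (ae_of_all _ fun p => ?_)
  refine (hA _).trans ?_
  have := abs_add_add_cube_le p.1 p.2 c
  gcongr

lemma CubicGrowth.integrable_step {g : ℝ → ℝ} (hg : CubicGrowth g) {ν : ℕ → Measure ℝ} {p : ℕ × ℕ}
    [IsFiniteMeasure (ν p.1)] [IsFiniteMeasure (ν p.2)]
    (hμ : Integrable (fun x => |x| ^ 3) (ν p.1)) (hν : Integrable (fun x => |x| ^ 3) (ν p.2)) :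
    Integrable g (Existence.step ν p) := by
  rw [Existence.step, integrable_map_measure hg.continuous.aestronglyMeasurable (by fun_prop)]
  exact hg.integrable_prod hμ hν 1

lemma IsRoundsLaw.eq_add_rest {ν : ℕ → Measure ℝ} (h : IsRoundsLaw ν) {n : ℕ} (hn : 2 ≤ n) :
    ν n = ENNReal.ofReal ((1 / 2) ^ n) • (ν n).map (fun x => x + 2) + Existence.rest n ν := by
  have := h.prob n
  have hmem : (n, 0) ∈ Finset.range (n + 1) ×ˢ Finset.range (n + 1) := by simp
  conv_lhs => rw [h.recurrence n hn, ← Finset.add_sum_erase _ _ hmem]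
  rw [Existence.rest]
  congr 1
  simp only [Existence.splitProb_n n (by omega)]
  congr 1
  rw [Existence.step, h.zero, Measure.prod_dirac, Measure.map_map (by fun_prop) (by fun_prop)]
  congr 1
  ext x; simp; ring

/-- The third moments are finite. The law `ν n` occurs on both sides of its recurrence, with the
weight `2⁻ⁿ` on the right, so that the bound is first derived for the truncated moments. -/
lemma IsRoundsLaw.integrable_abs_cube {ν : ℕ → Measure ℝ} (h : IsRoundsLaw ν) (n : ℕ) :
    Integrable (fun x => |x| ^ 3) (ν n) := by
  have hprob := h.prob
  induction n using Nat.strong_induction_on with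
  | _ n ih =>
    rcases lt_or_ge n 2 with hn | hn
    · interval_cases n
      · rw [h.zero]; exact integrable_dirac (by simp)
      · rw [h.one]; exact integrable_dirac (by simp)
    have hrest : Integrable (fun x => |x| ^ 3) (Existence.rest n ν) := by
      rw [Existence.rest, integrable_finsetSum_measure]
      rintro ⟨j, k⟩ hp
      by_cases h' : j < n ∧ k < n
      · exact (cubicGrowth_abs_cube.integrable_step (ih j h'.1) (ih k h'.2)).smul_measure
          ENNReal.ofReal_ne_top
      · simp at hp
        have : splitProb n j k = 0 := by
          rw [splitProb, if_neg (by omega), if_neg (by omega)]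
        simp [this]
    have hfin : IsFiniteMeasure (Existence.rest n ν) :=
      isFiniteMeasure_of_le (ν n) (by
        conv_rhs => rw [h.eq_add_rest hn]
        exact Measure.le_add_left le_rfl)
    set R := ∫ x, |x| ^ 3 ∂Existence.rest n ν with hR
    have hb : ∀ N : ℕ, ∀ μ : Measure ℝ, IsFiniteMeasure μ →
        Integrable (fun x : ℝ => (min |x| N) ^ 3) μ := by
      intro N μ _
      refine Integrable.of_bound (by fun_prop) ((N : ℝ) ^ 3) (ae_of_all _ fun x => ?_)
      have h0 : 0 ≤ min |x| (N : ℝ) := le_min (abs_nonneg _) (Nat.cast_nonneg _)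
      rw [Real.norm_of_nonneg (by positivity)]
      exact pow_le_pow_left₀ h0 (min_le_right _ _) 3
    have hA : ∀ N : ℕ, ∫ x, (min |x| (N : ℝ)) ^ 3 ∂ν n ≤ 500 + 2 * R := by
      intro N
      have h1 : ∫ x, (min |x| (N : ℝ)) ^ 3 ∂ν n = (1 / 2 : ℝ) ^ n *
          ∫ x, (min |x + 2| (N : ℝ)) ^ 3 ∂ν n + ∫ x, (min |x| (N : ℝ)) ^ 3 ∂Existence.rest n ν := by
        conv_lhs => rw [h.eq_add_rest hn]
        rw [integral_add_measure _ (hb N _ inferInstance), integral_smul_measure,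
          integral_map (by fun_prop) (by fun_prop), ENNReal.toReal_ofReal (by positivity),
          smul_eq_mul]
        exact (hb N _ (Measure.isFiniteMeasure_map _ _)).smul_measure ENNReal.ofReal_ne_top
      have h2 : ∫ x, (min |x| (N : ℝ)) ^ 3 ∂Existence.rest n ν ≤ R := by
        refine integral_mono (hb N _ inferInstance) hrest fun x => ?_
        exact pow_le_pow_left₀ (le_min (abs_nonneg _) (Nat.cast_nonneg _)) (min_le_left _ _) 3
      have h3 : ∫ x, (min |x + 2| (N : ℝ)) ^ 3 ∂ν n
          ≤ ∫ x, (2 * (min |x| (N : ℝ)) ^ 3 + 1000) ∂ν n := by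
        refine integral_mono_of_nonneg (ae_of_all _ fun x => ?_)
          (((hb N _ inferInstance).const_mul 2).add (integrable_const _)) (ae_of_all _ fun x => ?_)
        · have h0 : 0 ≤ min |x + 2| (N : ℝ) := le_min (abs_nonneg _) (Nat.cast_nonneg _)
          dsimp only [Pi.zero_apply]; positivity
        · have h0 : 0 ≤ min |x| (N : ℝ) := le_min (abs_nonneg _) (Nat.cast_nonneg _)
          have h0' : 0 ≤ min |x + 2| (N : ℝ) := le_min (abs_nonneg _) (Nat.cast_nonneg _)
          have h1 : min |x + 2| (N : ℝ) ≤ min |x| N + 2 := by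
            rw [← min_add_add_right]
            refine min_le_min ((abs_add_le _ _).trans (by norm_num)) (by linarith)
          refine (pow_le_pow_left₀ h0' h1 3).trans ?_
          dsimp only
          generalize min |x| (N : ℝ) = a at h0
          -- `(a + 2)³ ≤ 2 a³` as soon as `a ≥ 8`, and `(a + 2)³ ≤ 1000` below
          rcases le_total a 8 with h8 | h8
          · have : (a + 2) ^ 3 ≤ 10 ^ 3 := pow_le_pow_left₀ (by linarith) (by linarith) 3
            have : 0 ≤ a ^ 3 := by positivity
            linarith
          · have : (a + 2) ^ 3 ≤ (5 / 4 * a) ^ 3 := pow_le_pow_left₀ (by linarith) (by linarith) 3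
            have : 0 ≤ a ^ 3 := by positivity
            nlinarith
      rw [integral_add ((hb N _ inferInstance).const_mul 2) (integrable_const _),
          integral_const_mul,
        integral_const] at h3
      simp only [probReal_univ, smul_eq_mul, one_mul] at h3
      have h4 := half_pow_le_quarter hn
      have h5 : 0 ≤ ∫ x, (min |x + 2| (N : ℝ)) ^ 3 ∂ν n := integral_nonneg fun x => by
        have h0 : 0 ≤ min |x + 2| (N : ℝ) := le_min (abs_nonneg _) (Nat.cast_nonneg _)
        dsimp only [Pi.zero_apply]; positivity
      have h6 := mul_le_mul_of_nonneg_right h4 h5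
      linarith
    refine ⟨by fun_prop, ?_⟩
    have hlim := lintegral_tendsto_of_tendsto_of_monotone (μ := ν n)
      (f := fun (N : ℕ) x => ENNReal.ofReal ((min |x| (N : ℝ)) ^ 3))
      (F := fun x => ENNReal.ofReal (|x| ^ 3)) (fun N => by fun_prop)
      (ae_of_all _ fun x N M hNM => by
        refine ENNReal.ofReal_le_ofReal (pow_le_pow_left₀
          (le_min (abs_nonneg _) (Nat.cast_nonneg _)) (min_le_min le_rfl ?_) 3)
        exact_mod_cast hNM)
      (ae_of_all _ fun x => by
        apply tendsto_const_nhds.congr'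
        filter_upwards [eventually_ge_atTop ⌈|x|⌉₊] with N hN
        rw [min_eq_left (Nat.ceil_le.1 hN)])
    have hle : ∫⁻ x, ENNReal.ofReal (|x| ^ 3) ∂ν n ≤ ENNReal.ofReal (500 + 2 * R) := by
      refine le_of_tendsto' hlim fun N => ?_
      rw [← ofReal_integral_eq_lintegral_ofReal (hb N _ inferInstance) (ae_of_all _ fun x => by
        have h0 : 0 ≤ min |x| (N : ℝ) := le_min (abs_nonneg _) (Nat.cast_nonneg _)
        dsimp only [Pi.zero_apply]; positivity)]
      exact ENNReal.ofReal_le_ofReal (hA N)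
    rw [hasFiniteIntegral_iff_ofReal (ae_of_all _ fun x => by
      dsimp only [Pi.zero_apply]; positivity)]
    exact hle.trans_lt ENNReal.ofReal_lt_top

lemma IsRoundsLaw.integrable {ν : ℕ → Measure ℝ} (h : IsRoundsLaw ν) {g : ℝ → ℝ}
    (hg : CubicGrowth g) (n : ℕ) : Integrable g (ν n) := by
  have := h.prob n
  exact hg.integrable (h.integrable_abs_cube n)

lemma IsRoundsLaw.integral_eq {ν : ℕ → Measure ℝ} (h : IsRoundsLaw ν) {g : ℝ → ℝ}
    (hg : CubicGrowth g) {n : ℕ} (hn : 2 ≤ n) :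
    ∫ x, g x ∂ν n = splitMean n fun j k => ∫ y, ∫ x, g (x + y + 1) ∂ν j ∂ν k := by
  have hprob := h.prob
  have h1 : ∀ p : ℕ × ℕ, Integrable g (Existence.step ν p) := fun p =>
    hg.integrable_step (h.integrable_abs_cube _) (h.integrable_abs_cube _)
  rw [h.recurrence n hn, integral_finsetSum_measure
    (fun p _ => (h1 p).smul_measure ENNReal.ofReal_ne_top), Finset.sum_product, splitMean]
  refine Finset.sum_congr rfl fun j _ => Finset.sum_congr rfl fun k _ => ?_
  rw [integral_smul_measure, ENNReal.toReal_ofReal (Existence.splitProb_nonneg _ _ _), smul_eq_mul,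
    Existence.step, integral_map (by fun_prop) hg.continuous.aestronglyMeasurable]
  congr 1
  exact integral_prod_symm _
    (hg.integrable_prod (h.integrable_abs_cube _) (h.integrable_abs_cube _) 1)

/-! ### Growth of the third moments -/

lemma geomMean_three_halves_pow_le (n : ℕ) : geomMean (fun k => (3 / 2 : ℝ) ^ k) n ≤ 3 := by
  have h1 : ∀ n, ∑ k ∈ Finset.range n, (1 / 2 : ℝ) ^ (k + 1) * (3 / 2 : ℝ) ^ k
      = 2 - 2 * (3 / 4 : ℝ) ^ n := by
    intro n
    induction n with
    | zero => simp
    | succ n ih =>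
      rw [Finset.sum_range_succ, ih, pow_succ, show (3 / 4 : ℝ) = 1 / 2 * (3 / 2) by norm_num,
        mul_pow, mul_pow]
      ring
  have h2 : (1 / 2 : ℝ) ^ n ≤ 1 := pow_le_one₀ (by norm_num) (by norm_num)
  have h3 : (0 : ℝ) ≤ (3 / 4) ^ n := by positivity
  rw [geomMean, h1]
  simp only [pow_zero, mul_one]
  linarith

lemma geomMean_mono {g h : ℕ → ℝ} {n : ℕ} (h0 : g 0 ≤ h 0) (H : ∀ k < n, g k ≤ h k) :
    geomMean g n ≤ geomMean h n := by
  unfold geomMean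
  gcongr with k hk
  exact H k (Finset.mem_range.1 hk)

lemma geomMean_const_mul (c : ℝ) (h : ℕ → ℝ) (n : ℕ) :
    geomMean (fun j => c * h j) n = c * geomMean h n := by
  simp only [geomMean, mul_add, Finset.mul_sum]
  congr 1
  · ring
  · exact Finset.sum_congr rfl fun k _ => by ring

/-- A crude bound for the third moments, sufficient for averages over the geometric index. -/
lemma IsRoundsLaw.exists_abs_cube_le {ν : ℕ → Measure ℝ} (h : IsRoundsLaw ν) :
    ∃ K, ∀ n, ∫ x, |x| ^ 3 ∂ν n ≤ K * (3 / 2 : ℝ) ^ n := by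
  have hprob := h.prob
  set u : ℕ → ℝ := fun n => ∫ x, |x| ^ 3 ∂ν n with hu
  have hu0 : ∀ n, 0 ≤ u n := fun n => integral_nonneg fun x => by
    dsimp only [Pi.zero_apply]; positivity
  have hrec : ∀ n ≥ 2, u n ≤ 9 * (binomMean u n + geomMean u n + 1) := by
    intro n hn
    have h1 : u n ≤ splitMean n fun j k => 9 * (u j + u k + 1) := by
      simp only [hu]
      rw [h.integral_eq cubicGrowth_abs_cube hn]
      refine splitMean_mono fun j _ k _ => ?_
      have hj := h.integrable_abs_cube j
      have hk := h.integrable_abs_cube k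
      have h2 : ∀ y, ∫ x, |x + y + 1| ^ 3 ∂ν j ≤ 9 * (u j + |y| ^ 3 + 1) := by
        intro y
        have h3 : ∫ x, |x + y + 1| ^ 3 ∂ν j ≤ ∫ x, 9 * (|x| ^ 3 + |y| ^ 3 + 1) ∂ν j := by
          refine integral_mono_of_nonneg (ae_of_all _ fun x => by
            dsimp only [Pi.zero_apply]; positivity)
            (((hj.add (integrable_const _)).add (integrable_const _)).const_mul 9)
            (ae_of_all _ fun x => ?_)
          simpa using abs_add_add_cube_le x y 1
        refine h3.trans (le_of_eq ?_)
        simp_rw [add_assoc]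
        rw [integral_const_mul, integral_add hj (integrable_const _)]
        simp [hu]
      calc ∫ y, ∫ x, |x + y + 1| ^ 3 ∂ν j ∂ν k ≤ ∫ y, 9 * (u j + |y| ^ 3 + 1) ∂ν k := by
            refine integral_mono_of_nonneg (ae_of_all _ fun y => integral_nonneg fun x => by
              dsimp only [Pi.zero_apply]; positivity)
              ((((integrable_const _).add hk).add (integrable_const _)).const_mul 9)
              (ae_of_all _ h2)
        _ = 9 * (u j + u k + 1) := by
            simp_rw [add_right_comm (u j) _ (1 : ℝ)]
            rw [integral_const_mul, integral_add (integrable_const _) hk]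
            simp [hu]
    rw [splitMean_const_mul, splitMean_add, splitMean_add, splitMean_left n u, splitMean_right n u,
      splitMean_const] at h1
    exact h1
  set K := 1 + ∑ j ∈ Finset.range 14, u j with hK
  have hK1 : 1 ≤ K := by
    have : 0 ≤ ∑ j ∈ Finset.range 14, u j := Finset.sum_nonneg fun j _ => hu0 j
    linarith
  refine ⟨K, fun n => ?_⟩
  induction n using Nat.strong_induction_on with
  | _ n ih =>
    change u n ≤ _
    rcases lt_or_ge n 14 with hn | hn
    · have h1 : u n ≤ K := by
        have := Finset.single_le_sum (f := u) (fun j _ => hu0 j) (Finset.mem_range.2 hn)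
        linarith
      have h2 : (1 : ℝ) ≤ (3 / 2) ^ n := one_le_pow₀ (by norm_num)
      nlinarith
    by_contra! hlt
    have h1 : binomMean u n - K * (5 / 4 : ℝ) ^ n ≤ (1 / 2 : ℝ) ^ n * (u n - K * (3 / 2) ^ n) := by
      have h5 : binomMean (fun j => K * (3 / 2 : ℝ) ^ j) n = K * (5 / 4 : ℝ) ^ n := by
        rw [binomMean_const_mul, binomMean_pow]; norm_num
      rw [← h5, ← binomMean_sub, binomMean, Finset.sum_range_succ]
      have : ∑ j ∈ Finset.range n, (n.choose j : ℝ) * (1 / 2 : ℝ) ^ n * (u j - K * (3 / 2) ^ j)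
          ≤ 0 :=
        Finset.sum_nonpos fun j hj => mul_nonpos_of_nonneg_of_nonpos (by positivity)
          (by linarith [ih j (Finset.mem_range.1 hj)])
      simp only [Nat.choose_self, Nat.cast_one, one_mul]
      linarith
    have h2 : geomMean u n ≤ 3 * K := by
      have h3 : geomMean u n ≤ geomMean (fun k => K * (3 / 2 : ℝ) ^ k) n :=
        geomMean_mono (ih 0 (by omega)) fun k hk => ih k hk
      rw [geomMean_const_mul] at h3
      have := geomMean_three_halves_pow_le n
      nlinarith
    have h3 : 9 * (5 / 4 : ℝ) ^ n + 36 ≤ (3 / 2 : ℝ) ^ n := by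
      clear h1 h2 hlt ih
      induction n, hn using Nat.le_induction with
      | base => norm_num
      | succ m hm ih =>
        have : (0 : ℝ) ≤ (5 / 4) ^ m := by positivity
        rw [pow_succ, pow_succ]; linarith
    have h4 : (1 / 2 : ℝ) ^ n ≤ 1 / 18 :=
      (pow_le_pow_of_le_one (by norm_num) (by norm_num) hn).trans (by norm_num)
    have h6 := hrec n (by omega)
    have h7 : (1 / 2 : ℝ) ^ n * (u n - K * (3 / 2) ^ n) ≤ 1 / 18 * (u n - K * (3 / 2) ^ n) :=
      mul_le_mul_of_nonneg_right h4 (by linarith)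
    have h8 : K * (9 * (5 / 4 : ℝ) ^ n + 36) ≤ K * (3 / 2 : ℝ) ^ n :=
      mul_le_mul_of_nonneg_left h3 (by linarith)
    linarith

/-! ### Exponentially fast convergence of the geometric averages -/

lemma summable_half_pow_mul {g : ℕ → ℝ} {K : ℝ} (hg : ∀ k, |g k| ≤ K * (3 / 2 : ℝ) ^ k) :
    Summable fun k => (1 / 2 : ℝ) ^ (k + 1) * g k := by
  have h : Summable fun k : ℕ => K / 2 * (3 / 4 : ℝ) ^ k :=
    (summable_geometric_of_lt_one (by norm_num) (by norm_num)).mul_left _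
  refine h.of_norm_bounded fun k => ?_
  rw [Real.norm_eq_abs, abs_mul, abs_of_nonneg (by positivity : (0 : ℝ) ≤ (1 / 2) ^ (k + 1))]
  calc (1 / 2 : ℝ) ^ (k + 1) * |g k| ≤ (1 / 2 : ℝ) ^ (k + 1) * (K * (3 / 2 : ℝ) ^ k) := by
        gcongr; exact hg k
    _ = _ := by rw [show (3 / 4 : ℝ) = 1 / 2 * (3 / 2) by norm_num, mul_pow]; ring

/-- The mean of `g` at a geometric variable. -/
noncomputable def geomLimit (g : ℕ → ℝ) : ℝ := ∑' k : ℕ, (1 / 2 : ℝ) ^ (k + 1) * g k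

lemma abs_geomMean_sub_le {g : ℕ → ℝ} {K : ℝ} (hg : ∀ k, |g k| ≤ K * (3 / 2 : ℝ) ^ k) (n : ℕ) :
    |geomMean g n - geomLimit g| ≤ 3 * K * (3 / 4 : ℝ) ^ n := by
  have hs := summable_half_pow_mul hg
  have h0 : |g 0| ≤ K := by simpa using hg 0
  have h1 := hs.sum_add_tsum_nat_add n
  have h2 : |∑' k : ℕ, (1 / 2 : ℝ) ^ (k + n + 1) * g (k + n)| ≤ 2 * K * (3 / 4 : ℝ) ^ n := by
    have h3 : HasSum (fun k : ℕ => K / 2 * (3 / 4 : ℝ) ^ n * (3 / 4 : ℝ) ^ k)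
        (K / 2 * (3 / 4 : ℝ) ^ n * (1 - 3 / 4)⁻¹) :=
      (hasSum_geometric_of_lt_one (by norm_num) (by norm_num)).mul_left _
    have h4 := tsum_of_norm_bounded (f := fun k : ℕ => (1 / 2 : ℝ) ^ (k + n + 1) * g (k + n)) h3 ?_
    · rw [Real.norm_eq_abs] at h4
      refine h4.trans (le_of_eq ?_)
      norm_num; ring
    · intro k
      rw [Real.norm_eq_abs, abs_mul, abs_of_nonneg
          (by positivity : (0 : ℝ) ≤ (1 / 2) ^ (k + n + 1))]
      calc (1 / 2 : ℝ) ^ (k + n + 1) * |g (k + n)|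
          ≤ (1 / 2 : ℝ) ^ (k + n + 1) * (K * (3 / 2 : ℝ) ^ (k + n)) := by gcongr; exact hg _
        _ = _ := by
          rw [show (3 / 4 : ℝ) = 1 / 2 * (3 / 2) by norm_num, mul_pow, mul_pow]; ring
  have h5 : geomMean g n - geomLimit g
      = (1 / 2 : ℝ) ^ n * g 0 - ∑' k : ℕ, (1 / 2 : ℝ) ^ (k + n + 1) * g (k + n) := by
    rw [geomMean, geomLimit, ← h1]; ring
  have h6 : |(1 / 2 : ℝ) ^ n * g 0| ≤ (3 / 4 : ℝ) ^ n * K := by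
    rw [abs_mul, abs_of_nonneg (by positivity : (0 : ℝ) ≤ (1 / 2) ^ n)]
    exact mul_le_mul (pow_le_pow_left₀ (by norm_num) (by norm_num) n) h0 (abs_nonneg _)
      (by positivity)
  rw [h5]
  refine (abs_sub _ _).trans ?_
  linarith

lemma exists_three_quarters_pow_le :
    ∃ C, 0 ≤ C ∧ ∀ n : ℕ, (3 / 4 : ℝ) ^ n ≤ C / (((n : ℝ) + 1) * (n + 2)) := by
  have h : Summable fun n : ℕ => ((n : ℝ) + 1) * (n + 2) * (3 / 4 : ℝ) ^ n := by
    have h := fun k => summable_pow_mul_geometric_of_norm_lt_one k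
      (show ‖(3 / 4 : ℝ)‖ < 1 by norm_num)
    exact (((h 2).add ((h 1).mul_left 3)).add ((h 0).mul_left 2)).congr fun n => by ring
  refine ⟨∑' n : ℕ, ((n : ℝ) + 1) * (n + 2) * (3 / 4 : ℝ) ^ n,
    tsum_nonneg fun n => by positivity, fun n => ?_⟩
  rw [le_div_iff₀ (by positivity)]
  refine le_trans (le_of_eq ?_) (h.le_tsum n fun k _ => by positivity)
  ring

lemma exists_sum_mul_three_quarters_pow_le :
    ∃ C, 0 ≤ C ∧ ∀ n : ℕ, ∑ k ∈ Finset.range n, ((k : ℝ) + 1) * (k + 3) * (3 / 4 : ℝ) ^ k ≤ C := by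
  have h : Summable fun n : ℕ => ((n : ℝ) + 1) * (n + 3) * (3 / 4 : ℝ) ^ n := by
    have h := fun k => summable_pow_mul_geometric_of_norm_lt_one k
      (show ‖(3 / 4 : ℝ)‖ < 1 by norm_num)
    exact (((h 2).add ((h 1).mul_left 4)).add ((h 0).mul_left 3)).congr fun n => by ring
  refine ⟨∑' n : ℕ, ((n : ℝ) + 1) * (n + 3) * (3 / 4 : ℝ) ^ n,
    tsum_nonneg fun n => by positivity, fun n => ?_⟩
  exact h.sum_le_tsum (Finset.range n) fun k _ => by positivity

/-! ### Means and variances -/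

lemma CubicGrowth.const (c : ℝ) : CubicGrowth fun _ => c :=
  ⟨by fun_prop, |c|, fun x =>
    le_mul_of_one_le_right (abs_nonneg c) (by linarith [pow_nonneg (abs_nonneg x) 3])⟩

lemma CubicGrowth.add {f g : ℝ → ℝ} (hf : CubicGrowth f) (hg : CubicGrowth g) :
    CubicGrowth fun x => f x + g x := by
  obtain ⟨A, hA⟩ := hf.bound
  obtain ⟨B, hB⟩ := hg.bound
  refine ⟨hf.continuous.add hg.continuous, A + B, fun x => (abs_add_le _ _).trans ?_⟩
  rw [add_mul]
  exact add_le_add (hA x) (hB x)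

lemma CubicGrowth.const_mul {f : ℝ → ℝ} (hf : CubicGrowth f) (c : ℝ) :
    CubicGrowth fun x => c * f x := by
  obtain ⟨A, hA⟩ := hf.bound
  refine ⟨hf.continuous.const_mul c, |c| * A, fun x => ?_⟩
  rw [abs_mul, mul_assoc]
  exact mul_le_mul_of_nonneg_left (hA x) (abs_nonneg c)

lemma abs_le_one_add_cube (x : ℝ) : |x| ≤ 1 + |x| ^ 3 := by
  have := abs_nonneg x
  generalize |x| = a at *
  nlinarith [mul_nonneg this (sq_nonneg (a - 1)), sq_nonneg (a - 1), sq_nonneg a]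

lemma sq_le_one_add_cube (x : ℝ) : x ^ 2 ≤ 1 + |x| ^ 3 := by
  rw [← sq_abs]
  have := abs_nonneg x
  generalize |x| = a at *
  rcases le_total a 1 with h | h
  · nlinarith [pow_nonneg this 3]
  · nlinarith [mul_nonneg (sq_nonneg a) (sub_nonneg.2 h)]

lemma cubicGrowth_id : CubicGrowth fun x => x :=
  ⟨by fun_prop, 1, fun x => by rw [one_mul]; exact abs_le_one_add_cube x⟩

lemma cubicGrowth_sq : CubicGrowth fun x => x ^ 2 :=
  ⟨by fun_prop, 1, fun x => by
    rw [one_mul, abs_of_nonneg (sq_nonneg x)]; exact sq_le_one_add_cube x⟩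

lemma CubicGrowth.comp_add {f : ℝ → ℝ} (hf : CubicGrowth f) (c : ℝ) :
    CubicGrowth fun x => f (x + c) := by
  obtain ⟨A, hA⟩ := hf.bound
  have hA0 : 0 ≤ A := by
    have := (abs_nonneg _).trans (hA 0)
    simpa using this
  refine ⟨hf.continuous.comp (by fun_prop), A * (9 + 9 * |c| ^ 3), fun x => (hA _).trans ?_⟩
  rw [mul_assoc]
  refine mul_le_mul_of_nonneg_left ?_ hA0
  have h := abs_add_add_cube_le x c 0
  simp only [add_zero, abs_zero] at h
  nlinarith [pow_nonneg (abs_nonneg x) 3, pow_nonneg (abs_nonneg c) 3,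
    mul_nonneg (pow_nonneg (abs_nonneg x) 3) (pow_nonneg (abs_nonneg c) 3)]

/-- The mean of the number of rounds with `n` processors. -/
noncomputable def meanRounds (ν : ℕ → Measure ℝ) (n : ℕ) : ℝ := ∫ x, x ∂ν n

/-- The variance of the number of rounds with `n` processors. -/
noncomputable def varRounds (ν : ℕ → Measure ℝ) (n : ℕ) : ℝ := ∫ x, (x - meanRounds ν n) ^ 2 ∂ν n

lemma varRounds_nonneg (ν : ℕ → Measure ℝ) (n : ℕ) : 0 ≤ varRounds ν n :=
  integral_nonneg fun _ => sq_nonneg _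

section

variable {ν : ℕ → Measure ℝ} (h : IsRoundsLaw ν)
include h

lemma IsRoundsLaw.integral_add_const (n : ℕ) (c : ℝ) : ∫ x, (x + c) ∂ν n = meanRounds ν n + c := by
  have := h.prob n
  rw [integral_add (h.integrable cubicGrowth_id n) (integrable_const _), integral_const,
    probReal_univ, one_smul, meanRounds]

lemma IsRoundsLaw.integral_add_const_sq (n : ℕ) (c : ℝ) :
    ∫ x, (x + c) ^ 2 ∂ν n = varRounds ν n + (meanRounds ν n + c) ^ 2 := by
  have := h.prob n
  set m := meanRounds ν n with hm
  have h1 : ∀ x : ℝ, (x + c) ^ 2 = (x + -m) ^ 2 + (2 * (m + c) * (x + (-m)) + (m + c) ^ 2) := by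
    intro x; ring
  have h2 := h.integrable (cubicGrowth_sq.comp_add (-m)) n
  have h3 := (h.integrable (cubicGrowth_id.comp_add (-m)) n).const_mul (2 * (m + c))
  have h4 : Integrable (fun x => 2 * (m + c) * (x + -m) + (m + c) ^ 2) (ν n) :=
    h3.add (integrable_const _)
  rw [integral_congr_ae (ae_of_all _ h1), integral_add h2 h4, integral_add h3 (integrable_const _),
    integral_const_mul, h.integral_add_const, varRounds, ← hm]
  simp [sub_eq_add_neg]

lemma IsRoundsLaw.meanRounds_eq {n : ℕ} (hn : 2 ≤ n) : meanRounds ν n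
    = binomMean (meanRounds ν) n + geomMean (meanRounds ν) n + 1 := by
  have hprob := h.prob
  conv_lhs => rw [meanRounds, h.integral_eq cubicGrowth_id hn]
  have h0 : splitMean n (fun j k => meanRounds ν j + meanRounds ν k + 1)
      = binomMean (meanRounds ν) n + geomMean (meanRounds ν) n + 1 := by
    rw [splitMean_add, splitMean_add, splitMean_left n (meanRounds ν),
      splitMean_right n (meanRounds ν), splitMean_const]
  rw [← h0]
  refine splitMean_congr fun j _ k _ => ?_
  have h1 : ∀ y : ℝ, ∫ x, (x + y + 1) ∂ν j = y + (meanRounds ν j + 1) := by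
    intro y
    simp_rw [add_assoc]
    rw [h.integral_add_const]; ring
  simp_rw [h1]
  rw [h.integral_add_const]
  ring

lemma IsRoundsLaw.varRounds_eq {n : ℕ} (hn : 2 ≤ n) : varRounds ν n
    = splitMean n fun j k => varRounds ν j + varRounds ν k
        + (meanRounds ν j + meanRounds ν k + 1 - meanRounds ν n) ^ 2 := by
  have hprob := h.prob
  conv_lhs => rw [varRounds, h.integral_eq (g := fun x => (x - meanRounds ν n) ^ 2)
    (cubicGrowth_sq.comp_add (-meanRounds ν n)) hn]
  refine splitMean_congr fun j _ k _ => ?_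
  have h1 : ∀ y : ℝ, ∫ x, (x + y + 1 - meanRounds ν n) ^ 2 ∂ν j
      = (y + (meanRounds ν j + 1 - meanRounds ν n)) ^ 2 + varRounds ν j := by
    intro y
    simp_rw [show ∀ x : ℝ, x + y + 1 - meanRounds ν n = x +
        (y + 1 - meanRounds ν n) by intro x; ring]
    rw [h.integral_add_const_sq]; ring
  simp_rw [h1]
  rw [integral_add (h.integrable (cubicGrowth_sq.comp_add _) k) (integrable_const _),
    h.integral_add_const_sq]
  simp
  ring

/-- Mean, squared mean, variance and third absolute moment are all `O((3 / 2)ⁿ)`. -/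
lemma IsRoundsLaw.exists_moment_bounds : ∃ K, 0 ≤ K ∧ ∀ n,
    |meanRounds ν n| ≤ K * (3 / 2 : ℝ) ^ n ∧ |meanRounds ν n ^ 2| ≤ K * (3 / 2 : ℝ) ^ n ∧
    |varRounds ν n| ≤ K * (3 / 2 : ℝ) ^ n ∧ |∫ x, |x| ^ 3 ∂ν n| ≤ K * (3 / 2 : ℝ) ^ n := by
  obtain ⟨K, hK⟩ := h.exists_abs_cube_le
  have hK0 : 0 ≤ K := by
    have h0 : 0 ≤ ∫ x, |x| ^ 3 ∂ν 0 := integral_nonneg fun x => by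
      dsimp only [Pi.zero_apply]; positivity
    simpa using h0.trans (hK 0)
  refine ⟨K + 1, by positivity, fun n => ?_⟩
  have hprob := h.prob n
  have h1 : (1 : ℝ) ≤ (3 / 2) ^ n := one_le_pow₀ (by norm_num)
  have h3 := hK n
  have h30 : 0 ≤ ∫ x, |x| ^ 3 ∂ν n := integral_nonneg fun x => by
    dsimp only [Pi.zero_apply]; positivity
  have hc : ∫ x, (1 + |x| ^ 3) ∂ν n = 1 + ∫ x, |x| ^ 3 ∂ν n := by
    rw [integral_add (integrable_const _) (h.integrable_abs_cube n)]
    simp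
  have hci : Integrable (fun x => 1 + |x| ^ 3) (ν n) :=
      (integrable_const _).add (h.integrable_abs_cube n)
  have h4 : |meanRounds ν n| ≤ 1 + ∫ x, |x| ^ 3 ∂ν n := by
    rw [← hc]
    refine (abs_integral_le_integral_abs).trans ?_
    exact integral_mono (h.integrable cubicGrowth_id n).abs hci abs_le_one_add_cube
  have h5 : varRounds ν n + meanRounds ν n ^ 2 ≤ 1 + ∫ x, |x| ^ 3 ∂ν n := by
    have := h.integral_add_const_sq n 0
    simp only [add_zero] at this
    rw [← this, ← hc]
    exact integral_mono (h.integrable cubicGrowth_sq n) hci sq_le_one_add_cube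
  have h6 := varRounds_nonneg ν n
  have h7 := sq_nonneg (meanRounds ν n)
  rw [abs_of_nonneg h6, abs_of_nonneg h7, abs_of_nonneg h30]
  refine ⟨?_, ?_, ?_, ?_⟩ <;> linarith

/-- The mean is Lipschitz on the logarithmic scale. -/
lemma IsRoundsLaw.exists_mean_increment_le : ∃ A, 0 ≤ A ∧ ∀ n,
    |meanRounds ν (n + 1) - meanRounds ν n| ≤ A / ((n : ℝ) + 1) := by
  obtain ⟨K, hK0, hK⟩ := h.exists_moment_bounds
  obtain ⟨C, hC0, hC⟩ := exists_three_quarters_pow_le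
  set m := meanRounds ν with hm
  refine abs_le_inv_of_half_binomMean (x := fun n => m (n + 1) - m n) (K := K * C) fun n hn => ?_
  have h1 : m (n + 1) - m n - 1 / 2 * binomMean (fun n => m (n + 1) - m n) n
      = (1 / 2 : ℝ) ^ (n + 1) * (m n - m 0) := by
    have e1 := h.meanRounds_eq hn
    have e2 := h.meanRounds_eq (n := n + 1) (by omega)
    rw [← hm] at e1 e2
    rw [binomMean_succ] at e2
    simp only [geomMean, Finset.sum_range_succ] at e1 e2
    rw [binomMean_sub]
    linear_combination e2 - e1
  rw [h1, abs_mul, abs_of_nonneg (by positivity : (0 : ℝ) ≤ (1 / 2) ^ (n + 1))]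
  have h2 : |m n - m 0| ≤ 2 * K * (3 / 2 : ℝ) ^ n := by
    have h3 := (hK n).1
    have h4 := (hK 0).1
    have h5 : (1 : ℝ) ≤ (3 / 2) ^ n := one_le_pow₀ (by norm_num)
    refine (abs_sub _ _).trans ?_
    nlinarith
  calc (1 / 2 : ℝ) ^ (n + 1) * |m n - m 0| ≤ (1 / 2 : ℝ) ^ (n + 1) * (2 * K * (3 / 2 : ℝ) ^ n) := by
        gcongr
    _ = K * (3 / 4 : ℝ) ^ n := by
        rw [show (3 / 4 : ℝ) = 1 / 2 * (3 / 2) by norm_num, mul_pow]; ring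
    _ ≤ K * (C / (((n : ℝ) + 1) * (n + 2))) := by gcongr; exact hC n
    _ = _ := by ring

omit h in
/-- A binomial average of a function with increments `O(1 / n)` has increments `O(1 / n)`; this
compares the mean of `m` at `1 + B` for a binomial variable `B` with parameter `l` with the one at a
binomial variable with parameter `l + d`. -/
lemma abs_binomMean_shift_sub_le {m : ℕ → ℝ} {A : ℝ} (hA : 0 ≤ A)
    (hm : ∀ n, |m (n + 1) - m n| ≤ A / ((n : ℝ) + 1)) (l d : ℕ) :
    |binomMean (fun i => m (i + 1)) l - binomMean m (l + d)| ≤ A * (d + 2) / ((l : ℝ) + 1) := by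
  have h1 : ∀ n, |binomMean (fun i => m (i + 1)) n - binomMean m n| ≤ 2 * A / ((n : ℝ) + 1) := by
    intro n
    rw [← binomMean_sub]
    refine (abs_binomMean_le _ _).trans ((binomMean_mono (h := fun j => A * (1 / ((j : ℝ) + 1)))
      fun j _ => by rw [mul_one_div]; exact hm j).trans ?_)
    rw [binomMean_const_mul, binomMean_inv, ← mul_div_assoc]
    have : 0 ≤ A * (1 / 2) ^ n := by positivity
    refine div_le_div_of_nonneg_right ?_ (by positivity)
    linarith
  have h2 : ∀ d : ℕ, |binomMean m l - binomMean m (l + d)| ≤ A * d / ((l : ℝ) + 1) := by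
    intro d
    induction d with
    | zero => simp
    | succ d ih =>
      have h3 : |binomMean m (l + d) - binomMean m (l + d + 1)| ≤ A / ((l : ℝ) + 1) := by
        have h4 : binomMean m (l + d) - binomMean m (l + d + 1)
            = -(1 / 2) * (binomMean (fun i => m (i + 1)) (l + d) - binomMean m (l + d)) := by
          rw [binomMean_succ]; ring
        rw [h4, abs_mul, abs_neg, abs_of_pos (by norm_num : (0 : ℝ) < 1 / 2)]
        have h5 := h1 (l + d)
        have h6 : 2 * A / (((l + d : ℕ) : ℝ) + 1) ≤ 2 * A / ((l : ℝ) + 1) := by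
          gcongr; omega
        have h7 : 2 * A / ((l : ℝ) + 1) = 2 * (A / ((l : ℝ) + 1)) := by ring
        linarith
      have h8 := abs_sub_le (binomMean m l) (binomMean m (l + d)) (binomMean m (l + d + 1))
      rw [← add_assoc]
      push_cast
      rw [mul_add, add_div, mul_one]
      linarith
  have h3 := abs_sub_le (binomMean (fun i => m (i + 1)) l) (binomMean m l) (binomMean m (l + d))
  have h4 := h1 l
  have h5 := h2 d
  rw [show A * ((d : ℝ) + 2) / ((l : ℝ) + 1) = 2 * A / ((l : ℝ) + 1) + A * d /
      ((l : ℝ) + 1) by ring]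
  linarith

/-- The two subproblem sizes are almost uncorrelated. -/
lemma IsRoundsLaw.exists_abs_covariance_le : ∃ C, ∀ n ≥ 2,
    |splitMean n fun j k => (meanRounds ν j - binomMean (meanRounds ν) n)
      * (meanRounds ν k - geomMean (meanRounds ν) n)| ≤ C / ((n : ℝ) + 1) := by
  obtain ⟨K, hK0, hK⟩ := h.exists_moment_bounds
  obtain ⟨A, hA0, hA⟩ := h.exists_mean_increment_le
  obtain ⟨C, hC0, hC⟩ := exists_three_quarters_pow_le
  obtain ⟨C', hC'0, hC'⟩ := exists_sum_mul_three_quarters_pow_le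
  set m := meanRounds ν with hm
  refine ⟨8 * K ^ 2 * C + 4 * K * A * C', fun n hn => ?_⟩
  have hn0 : (2 : ℝ) ≤ n := by exact_mod_cast hn
  have hB : ∀ k, |m k - geomMean m n| ≤ 4 * K * (3 / 2 : ℝ) ^ k := by
    intro k
    have h1 : |geomMean m n| ≤ 3 * K := by
      have h2 : |geomMean m n| ≤ geomMean (fun k => K * (3 / 2 : ℝ) ^ k) n := by
        rw [← splitMean_right, ← splitMean_right]
        exact (abs_splitMean_le _ _).trans (splitMean_mono fun j _ k _ => (hK k).1)
      rw [geomMean_const_mul] at h2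
      nlinarith [geomMean_three_halves_pow_le n]
    have h2 : (1 : ℝ) ≤ (3 / 2) ^ k := one_le_pow₀ (by norm_num)
    refine (abs_sub _ _).trans ?_
    nlinarith [(hK k).1]
  have hA' : |m 0 - binomMean m n| ≤ 2 * K * (5 / 4 : ℝ) ^ n := by
    have h1 : |binomMean m n| ≤ K * (5 / 4 : ℝ) ^ n := by
      refine (abs_binomMean_le _ _).trans ((binomMean_mono fun j _ => (hK j).1).trans ?_)
      rw [binomMean_const_mul, binomMean_pow]; norm_num
    have h2 : (1 : ℝ) ≤ (5 / 4) ^ n := one_le_pow₀ (by norm_num)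
    have h3 : |m 0| ≤ K := by simpa using (hK 0).1
    refine (abs_sub _ _).trans ?_
    nlinarith
  rw [splitMean_eq]
  have hterm : ∀ k ∈ Finset.range n, |(1 / 2 : ℝ) ^ (k + 1)
      * binomMean (fun i => (m (i + 1) - binomMean m n) * (m k - geomMean m n)) (n - 1 - k)|
      ≤ 4 * K * A / (n + 1) * (((k : ℝ) + 1) * (k + 3) * (3 / 4 : ℝ) ^ k) := by
    intro k hk
    have hk := Finset.mem_range.1 hk
    obtain ⟨l, rfl⟩ : ∃ l, n = l + (k + 1) := ⟨n - 1 - k, by omega⟩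
    rw [show l + (k + 1) - 1 - k = l by omega]
    set N := l + (k + 1) with hN
    rw [show (fun i => (m (i + 1) - binomMean m N) * (m k - geomMean m N))
      = fun i => (m k - geomMean m N) * (m (i + 1) - binomMean m N) by ext; ring,
      binomMean_const_mul, binomMean_sub, binomMean_const, abs_mul, abs_mul,
      abs_of_nonneg (by positivity : (0 : ℝ) ≤ (1 / 2) ^ (k + 1))]
    have h1 := abs_binomMean_shift_sub_le hA0 hA l (k + 1)
    rw [← hN] at h1
    have h2 : A * (((k + 1 : ℕ) : ℝ) + 2) / ((l : ℝ) + 1)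
        ≤ 2 * A * (k + 1) * (k + 3) / (N + 1) := by
      rw [div_le_div_iff₀ (by positivity) (by positivity), hN]
      push_cast
      have : 0 ≤ A * ((k : ℝ) + 3) * ((2 * (k + 1) * (l + 1)) - (l + (k + 1) + 1)) := by
        apply mul_nonneg (by positivity)
        nlinarith [(Nat.cast_nonneg k : (0 : ℝ) ≤ k), (Nat.cast_nonneg l : (0 : ℝ) ≤ l),
          mul_nonneg (Nat.cast_nonneg k : (0 : ℝ) ≤ k) (Nat.cast_nonneg l : (0 : ℝ) ≤ l)]
      linarith
    calc (1 / 2 : ℝ) ^ (k + 1) * (|m k - geomMean m N|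
          * |binomMean (fun i => m (i + 1)) l - binomMean m N|)
        ≤ (1 / 2 : ℝ) ^ (k + 1) * ((4 * K * (3 / 2 : ℝ) ^ k)
          * (2 * A * (k + 1) * (k + 3) / (N + 1))) := by
          gcongr
          · exact hB k
          · exact h1.trans h2
      _ = _ := by rw [show (3 / 4 : ℝ) = 1 / 2 * (3 / 2) by norm_num, mul_pow]; ring
  have hfirst : |(1 / 2 : ℝ) ^ n * ((m 0 - binomMean m n) * (m 0 - geomMean m n))|
      ≤ 8 * K ^ 2 * C / (n + 1) := by
    rw [abs_mul, abs_mul, abs_of_nonneg (by positivity : (0 : ℝ) ≤ (1 / 2) ^ n)]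
    have h1 := hB 0
    rw [pow_zero, mul_one] at h1
    calc (1 / 2 : ℝ) ^ n * (|m 0 - binomMean m n| * |m 0 - geomMean m n|)
        ≤ (1 / 2 : ℝ) ^ n * ((2 * K * (5 / 4 : ℝ) ^ n) * (4 * K)) := by gcongr
      _ = 8 * K ^ 2 * (5 / 8 : ℝ) ^ n := by
          rw [show (5 / 8 : ℝ) = 1 / 2 * (5 / 4) by norm_num, mul_pow]; ring
      _ ≤ 8 * K ^ 2 * (3 / 4 : ℝ) ^ n := mul_le_mul_of_nonneg_left
          (pow_le_pow_left₀ (by norm_num) (by norm_num) n) (by positivity)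
      _ ≤ 8 * K ^ 2 * (C / (n + 1)) := by
          gcongr
          refine (hC n).trans ?_
          gcongr
          nlinarith
      _ = _ := by ring
  refine (abs_add_le _ _).trans ?_
  have hsum : |∑ k ∈ Finset.range n, (1 / 2 : ℝ) ^ (k + 1)
      * binomMean (fun i => (m (i + 1) - binomMean m n) * (m k - geomMean m n)) (n - 1 - k)|
      ≤ 4 * K * A / (n + 1) * C' := by
    refine (Finset.abs_sum_le_sum_abs _ _).trans ((Finset.sum_le_sum hterm).trans ?_)
    rw [← Finset.mul_sum]
    gcongr
    exact hC' n
  calc _ ≤ 8 * K ^ 2 * C / (n + 1) + 4 * K * A / (n + 1) * C' := add_le_add hfirst hsum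
    _ = _ := by ring

/-- The variance added in one step converges to a constant, with the rate `1 / n`. -/
lemma IsRoundsLaw.exists_variance_toll : ∃ C, ∀ n ≥ 2,
    |varRounds ν n - binomMean (varRounds ν) n - (geomLimit (varRounds ν)
      + (geomLimit (fun k => meanRounds ν k ^ 2) - geomLimit (meanRounds ν) ^ 2))|
      ≤ C / ((n : ℝ) + 1) := by
  obtain ⟨K, hK0, hK⟩ := h.exists_moment_bounds
  obtain ⟨A, hA0, hA⟩ := h.exists_mean_increment_le
  obtain ⟨C, hC0, hC⟩ := exists_three_quarters_pow_le
  obtain ⟨C', hC'⟩ := h.exists_abs_covariance_le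
  set m := meanRounds ν with hm
  set s := varRounds ν with hs
  set μ := geomLimit m with hμ
  refine ⟨3 * K * C + 3 * K * C + 3 * K * (2 * |μ| + 3 * K) * C + 2 * A ^ 2 + 2 * C',
    fun n hn => ?_⟩
  have hn0 : (2 : ℝ) ≤ n := by exact_mod_cast hn
  have hpow : (3 / 4 : ℝ) ^ n ≤ C / (n + 1) := by
    refine (hC n).trans ?_
    gcongr
    nlinarith
  have hpow1 : (3 / 4 : ℝ) ^ n ≤ 1 := pow_le_one₀ (by norm_num) (by norm_num)
  set g := geomMean m n with hg
  set t := binomMean m n with ht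
  have hmean : m n = t + g + 1 := h.meanRounds_eq hn
  have hexp : s n = binomMean s n + geomMean s n + (binomMean (fun j => m j ^ 2) n - t ^ 2)
      + (geomMean (fun k => m k ^ 2) n - g ^ 2)
      + 2 * splitMean n (fun j k => (m j - t) * (m k - g)) := by
    have e1 : s n = splitMean n fun j k => s j + s k + (((m j ^ 2 - 2 * t * m j) + t ^ 2)
        + ((m k ^ 2 - 2 * g * m k) + g ^ 2) + 2 * ((m j - t) * (m k - g))) := by
      rw [hs, h.varRounds_eq hn]
      refine splitMean_congr fun j _ k _ => ?_
      rw [← hm, hmean]; ring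
    rw [e1]
    simp only [splitMean_add, splitMean_sub, splitMean_const_mul, splitMean_const,
      splitMean_left n s, splitMean_right n s, splitMean_left n m, splitMean_right n m,
      splitMean_left n (fun j => m j ^ 2), splitMean_right n (fun j => m j ^ 2), ← ht, ← hg]
    ring
  have b1 : |geomMean s n - geomLimit s| ≤ 3 * K * C / (n + 1) := by
    refine (abs_geomMean_sub_le (fun k => (hK k).2.2.1) n).trans ?_
    rw [mul_div_assoc]; gcongr
  have b2 : |geomMean (fun k => m k ^ 2) n - geomLimit (fun k => m k ^ 2)|
      ≤ 3 * K * C / (n + 1) := by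
    refine (abs_geomMean_sub_le (fun k => (hK k).2.1) n).trans ?_
    rw [mul_div_assoc]; gcongr
  have b3 : |g ^ 2 - μ ^ 2| ≤ 3 * K * (2 * |μ| + 3 * K) * C / (n + 1) := by
    have h1 := abs_geomMean_sub_le (fun k => (hK k).1) n
    rw [← hg, ← hμ] at h1
    have h2 : |g + μ| ≤ 2 * |μ| + 3 * K := by
      have : g + μ = (g - μ) + 2 * μ := by ring
      rw [this]
      refine (abs_add_le _ _).trans ?_
      rw [abs_mul, abs_two]
      nlinarith
    rw [show g ^ 2 - μ ^ 2 = (g - μ) * (g + μ) by ring, abs_mul]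
    calc |g - μ| * |g + μ| ≤ (3 * K * (C / (n + 1))) * (2 * |μ| + 3 * K) := by
          gcongr
          refine h1.trans ?_
          gcongr
      _ = _ := by ring
  have b4 : |binomMean (fun j => m j ^ 2) n - t ^ 2| ≤ 2 * A ^ 2 / (n + 1) := by
    rw [abs_of_nonneg (by linarith [binomMean_sq_le m n])]
    obtain ⟨l, rfl⟩ : ∃ l, n = l + 1 := ⟨n - 1, by omega⟩
    refine (binomMean_variance_le m l).trans ?_
    have h1 : binomMean (fun j => (m (j + 1) - m j) ^ 2) l
        ≤ 2 * A ^ 2 * (4 / (((l : ℝ) + 1) * (l + 2))) := by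
      have h2 : ∀ j ≤ l, (m (j + 1) - m j) ^ 2 ≤ 2 * A ^ 2 * (1 / (((j : ℝ) + 1) * (j + 2))) := by
        intro j _
        rw [← sq_abs]
        refine (pow_le_pow_left₀ (abs_nonneg _) (hA j) 2).trans ?_
        rw [div_pow, mul_one_div, div_le_div_iff₀ (by positivity) (by positivity)]
        have : 0 ≤ A ^ 2 * ((j : ℝ) + 1) * (2 * (j + 1) - (j + 2)) := by
          apply mul_nonneg (by positivity)
          linarith [(Nat.cast_nonneg j : (0 : ℝ) ≤ j)]
        linarith
      refine (binomMean_mono h2).trans ?_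
      rw [binomMean_const_mul, binomMean_inv_mul_inv]
      gcongr
      have : (0 : ℝ) ≤ (l + 3) * (1 / 2) ^ l := by positivity
      linarith
    calc ((l : ℝ) + 1) / 4 * binomMean (fun j => (m (j + 1) - m j) ^ 2) l
        ≤ ((l : ℝ) + 1) / 4 * (2 * A ^ 2 * (4 / (((l : ℝ) + 1) * (l + 2)))) := by gcongr
      _ = _ := by push_cast; field_simp; ring
  have b5 := hC' n hn
  have hdecomp : s n - binomMean s n - (geomLimit s + (geomLimit (fun k => m k ^ 2) - μ ^ 2))
      = (geomMean s n - geomLimit s) + (geomMean (fun k => m k ^ 2) n - geomLimit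
          (fun k => m k ^ 2))
        - (g ^ 2 - μ ^ 2) + (binomMean (fun j => m j ^ 2) n - t ^ 2)
        + 2 * splitMean n (fun j k => (m j - t) * (m k - g)) := by
    linear_combination hexp
  rw [hdecomp]
  simp only [add_div]
  rw [mul_div_assoc 2 C']
  rw [abs_le] at *
  constructor <;> linarith [b1.1, b1.2, b2.1, b2.2, b3.1, b3.2, b4.1, b4.2, b5.1, b5.2]

lemma IsRoundsLaw.meanRounds_two : meanRounds ν 2 = 11 / 3 := by
  have h0 : meanRounds ν 0 = 1 := by simp [meanRounds, h.zero]
  have h1 : meanRounds ν 1 = 1 := by simp [meanRounds, h.one]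
  have h2 := h.meanRounds_eq (n := 2) le_rfl
  simp [geomMean, binomMean, Finset.sum_range_succ, h0, h1] at h2
  linarith

lemma IsRoundsLaw.variance_toll_pos : 0 < geomLimit (varRounds ν)
      + (geomLimit (fun k => meanRounds ν k ^ 2) - geomLimit (meanRounds ν) ^ 2) := by
  obtain ⟨K, hK0, hK⟩ := h.exists_moment_bounds
  set m := meanRounds ν with hm
  set μ := geomLimit m with hμ
  have h1 : 0 ≤ geomLimit (varRounds ν) :=
    tsum_nonneg fun k => mul_nonneg (by positivity) (varRounds_nonneg ν k)
  have s1 := summable_half_pow_mul fun k => (hK k).1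
  have s2 := summable_half_pow_mul fun k => (hK k).2.1
  have s3 : HasSum (fun k : ℕ => (1 / 2 : ℝ) ^ (k + 1) * μ ^ 2) (1 * μ ^ 2) := by
    have := hasSum_geometric_two' 1
    simp only [pow_succ, one_div_pow]
    refine HasSum.mul_right _ (this.congr_fun fun k => ?_)
    ring
  have h2 : HasSum (fun k : ℕ => (1 / 2 : ℝ) ^ (k + 1) * (m k - μ) ^ 2)
      (geomLimit (fun k => m k ^ 2) - μ ^ 2) := by
    have := (s2.hasSum.sub (s1.hasSum.mul_left (2 * μ))).add s3
    convert! this using 1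
    · ext k; ring
    · simp only [geomLimit, hμ]; ring
  have h3 := sum_le_hasSum (Finset.range 3) (fun k _ => by positivity) h2
  have hm0 : m 0 = 1 := by simp [hm, meanRounds, h.zero]
  have hm2 : m 2 = 11 / 3 := h.meanRounds_two
  have hm1 : m 1 = 1 := by simp [hm, meanRounds, h.one]
  simp only [Finset.sum_range_succ, Finset.sum_range_zero, hm0, hm1, hm2] at h3
  nlinarith [sq_nonneg (μ - 4 / 3)]

/-- The variance is a positive multiple of `log n`, up to a bounded error. -/
theorem IsRoundsLaw.exists_variance_asymptotics : ∃ σ, 0 < σ ∧ ∃ M, ∀ n,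
    |varRounds ν n - σ * harmonic n| ≤ M := by
  obtain ⟨C, hC⟩ := h.exists_variance_toll
  exact ⟨_, div_pos h.variance_toll_pos (by linarith [half_le_harmonicDrift]),
    abs_sub_harmonic_le_of_binomMean hC⟩

end

/-! ### Taylor expansion in the class of the Zolotarev metric -/

section Taylor

variable {f : ℝ → ℝ} (hf : f ∈ lipschitzTwo)
include hf

lemma hasDerivAt_of_mem_lipschitzTwo (x : ℝ) : HasDerivAt f (deriv f x) x :=
  (hf.1.differentiable (by norm_num) x).hasDerivAt

lemma hasDerivAt_deriv_of_mem_lipschitzTwo (x : ℝ) :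
    HasDerivAt (deriv f) (iteratedDeriv 2 f x) x := by
  have h := hf.1.differentiable_iteratedDeriv 1 (by norm_num)
  rw [iteratedDeriv_one] at h
  have h2 := (h x).hasDerivAt
  rwa [← iteratedDeriv_one, ← iteratedDeriv_succ, iteratedDeriv_one] at h2

lemma abs_deriv_sub_le_of_mem_lipschitzTwo (x w : ℝ) :
    |deriv f (x + w) - deriv f x - w * iteratedDeriv 2 f x| ≤ w ^ 2 := by
  have hd : ∀ y, HasDerivAt (fun y => deriv f (x + y) - y * iteratedDeriv 2 f x)
      (iteratedDeriv 2 f (x + y) - 1 * iteratedDeriv 2 f x) y := fun y =>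
    ((hasDerivAt_deriv_of_mem_lipschitzTwo hf (x + y)).comp_const_add x y).sub
      ((hasDerivAt_id y).mul_const _)
  have := Convex.norm_image_sub_le_of_norm_hasDerivWithin_le (s := Set.Icc (-|w|) |w|)
    (C := |w|) (x := 0) (y := w) (fun y _ => (hd y).hasDerivWithinAt) (fun y hy => by
      rw [one_mul]
      refine (hf.2 _ _).trans ?_
      rw [add_sub_cancel_left]
      exact abs_le.2 hy) (convex_Icc _ _) ⟨by simp, by simp⟩ ⟨neg_abs_le w, le_abs_self w⟩
  simp only [add_zero, zero_mul, sub_zero, Real.norm_eq_abs, abs_mul_abs_self] at this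
  rw [sq]
  refine le_trans (le_of_eq ?_) this
  congr 1
  ring

lemma abs_taylor_le_of_mem_lipschitzTwo (x w : ℝ) :
    |f (x + w) - f x - w * deriv f x - w ^ 2 / 2 * iteratedDeriv 2 f x| ≤ |w| ^ 3 := by
  have hd : ∀ y, HasDerivAt (fun y => f (x + y) - y * deriv f x - y ^ 2 / 2 * iteratedDeriv 2 f x)
      (deriv f (x + y) - 1 * deriv f x - y * iteratedDeriv 2 f x) y := fun y => by
    have h1 := (((hasDerivAt_of_mem_lipschitzTwo hf (x + y)).comp_const_add x y).sub
      ((hasDerivAt_id y).mul_const (deriv f x))).sub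
      (((hasDerivAt_pow 2 y).div_const 2).mul_const (iteratedDeriv 2 f x))
    convert! h1 using 1
    simp
  have := Convex.norm_image_sub_le_of_norm_hasDerivWithin_le (s := Set.Icc (-|w|) |w|)
    (C := |w| ^ 2) (x := 0) (y := w) (fun y _ => (hd y).hasDerivWithinAt) (fun y hy => by
      rw [one_mul]
      refine (abs_deriv_sub_le_of_mem_lipschitzTwo hf x y).trans ?_
      rw [← sq_abs y]
      exact pow_le_pow_left₀ (abs_nonneg _) (abs_le.2 hy) 2) (convex_Icc _ _)
    ⟨by simp, by simp⟩ ⟨neg_abs_le w, le_abs_self w⟩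
  rw [pow_succ _ 2]
  refine le_trans (le_of_eq ?_) ((this.trans (le_of_eq ?_)))
  · rw [Real.norm_eq_abs]
    congr 1
    simp
    ring
  · simp

lemma cubicGrowth_iteratedDeriv_two : CubicGrowth (iteratedDeriv 2 f) := by
  refine ⟨hf.1.continuous_iteratedDeriv 2 (by norm_num), |iteratedDeriv 2 f 0| + 1, fun x => ?_⟩
  have h1 := hf.2 x 0
  rw [sub_zero] at h1
  have h2 : |iteratedDeriv 2 f x| ≤ |iteratedDeriv 2 f x - iteratedDeriv 2 f 0|
      + |iteratedDeriv 2 f 0| := by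
    have := abs_add_le (iteratedDeriv 2 f x - iteratedDeriv 2 f 0) (iteratedDeriv 2 f 0)
    rwa [sub_add_cancel] at this
  have h3 := abs_le_one_add_cube x
  have h4 := mul_nonneg (abs_nonneg (iteratedDeriv 2 f 0)) (pow_nonneg (abs_nonneg x) 3)
  linarith

lemma cubicGrowth_deriv : CubicGrowth (deriv f) := by
  refine ⟨hf.1.continuous_deriv (by norm_num), |deriv f 0| + |iteratedDeriv 2 f 0| + 1,
    fun x => ?_⟩
  have h1 := abs_deriv_sub_le_of_mem_lipschitzTwo hf 0 x
  rw [zero_add] at h1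
  have h2 : |deriv f x| ≤ |deriv f x - deriv f 0 - x * iteratedDeriv 2 f 0|
      + |deriv f 0| + |x| * |iteratedDeriv 2 f 0| := by
    rw [← abs_mul]
    have := abs_add_three (deriv f x - deriv f 0 - x * iteratedDeriv 2 f 0) (deriv f 0)
      (x * iteratedDeriv 2 f 0)
    rwa [show deriv f x - deriv f 0 - x * iteratedDeriv 2 f 0 + deriv f 0 + x * iteratedDeriv 2 f 0
      = deriv f x by ring] at this
  have h3 := mul_le_mul_of_nonneg_right (abs_le_one_add_cube x) (abs_nonneg (iteratedDeriv 2 f 0))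
  have h5 := sq_le_one_add_cube x
  have h4 := mul_nonneg (abs_nonneg (deriv f 0)) (pow_nonneg (abs_nonneg x) 3)
  linarith

lemma cubicGrowth_of_mem_lipschitzTwo : CubicGrowth f := by
  refine ⟨hf.1.continuous, |f 0| + |deriv f 0| + |iteratedDeriv 2 f 0| + 1, fun x => ?_⟩
  have h1 := abs_taylor_le_of_mem_lipschitzTwo hf 0 x
  rw [zero_add] at h1
  have h2 : |f x| ≤ |f x - f 0 - x * deriv f 0 - x ^ 2 / 2 * iteratedDeriv 2 f 0|
      + (|f 0| + |x| * |deriv f 0| + x ^ 2 / 2 * |iteratedDeriv 2 f 0|) := by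
    have e1 := abs_add_le (f x - f 0 - x * deriv f 0 - x ^ 2 / 2 * iteratedDeriv 2 f 0)
      (f 0 + x * deriv f 0 + x ^ 2 / 2 * iteratedDeriv 2 f 0)
    have e2 := abs_add_three (f 0) (x * deriv f 0) (x ^ 2 / 2 * iteratedDeriv 2 f 0)
    rw [abs_mul, abs_mul, abs_of_nonneg (by positivity : 0 ≤ x ^ 2 / 2)] at e2
    rw [show f x - f 0 - x * deriv f 0 - x ^ 2 / 2 * iteratedDeriv 2 f 0
      + (f 0 + x * deriv f 0 + x ^ 2 / 2 * iteratedDeriv 2 f 0) = f x by ring] at e1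
    linarith
  have h3 := mul_le_mul_of_nonneg_right (abs_le_one_add_cube x) (abs_nonneg (deriv f 0))
  have h5 := mul_le_mul_of_nonneg_right (sq_le_one_add_cube x) (abs_nonneg (iteratedDeriv 2 f 0))
  have h4 := mul_nonneg (abs_nonneg (f 0)) (pow_nonneg (abs_nonneg x) 3)
  have h6 := mul_nonneg (sq_nonneg x) (abs_nonneg (iteratedDeriv 2 f 0))
  have h7 := pow_nonneg (abs_nonneg x) 3
  linarith

end Taylor

lemma comp_add_mem_lipschitzTwo {f : ℝ → ℝ} (hf : f ∈ lipschitzTwo) (c : ℝ) :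
    (fun x => f (x + c)) ∈ lipschitzTwo := by
  refine ⟨hf.1.comp (by fun_prop), fun x y => ?_⟩
  rw [iteratedDeriv_comp_add_const]
  simpa using hf.2 (x + c) (y + c)

lemma smul_comp_mul_mem_lipschitzTwo {f : ℝ → ℝ} (hf : f ∈ lipschitzTwo) {c : ℝ} (hc : c ≠ 0) :
    (fun x => (|c| ^ 3)⁻¹ * f (c * x)) ∈ lipschitzTwo := by
  refine ⟨contDiff_const.mul (hf.1.comp (by fun_prop)), fun x y => ?_⟩
  have hcomp : ContDiff ℝ 2 (fun x => f (c * x)) := hf.1.comp (by fun_prop)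
  have h1 : ∀ x, iteratedDeriv 2 (fun x => (|c| ^ 3)⁻¹ * f (c * x)) x
      = (|c| ^ 3)⁻¹ * (c ^ 2 * iteratedDeriv 2 f (c * x)) := by
    intro x
    rw [iteratedDeriv_const_mul _ hcomp.contDiffAt, iteratedDeriv_comp_const_mul hf.1]
  have hc' : 0 < |c| := abs_pos.2 hc
  rw [h1, h1, ← mul_sub, ← mul_sub, abs_mul, abs_mul, abs_of_nonneg
      (by positivity : 0 ≤ (|c| ^ 3)⁻¹),
    abs_of_nonneg (sq_nonneg c)]
  have h2 := hf.2 (c * x) (c * y)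
  rw [← mul_sub, abs_mul] at h2
  calc (|c| ^ 3)⁻¹ * (c ^ 2 * |iteratedDeriv 2 f (c * x) - iteratedDeriv 2 f (c * y)|)
      ≤ (|c| ^ 3)⁻¹ * (c ^ 2 * (|c| * |x - y|)) := by gcongr
    _ = |x - y| := by rw [← sq_abs]; field_simp

lemma zero_mem_lipschitzTwo : (fun _ => (0 : ℝ)) ∈ lipschitzTwo := by
  refine ⟨contDiff_const, fun x y => ?_⟩
  have h : iteratedDeriv 2 (fun _ : ℝ => (0 : ℝ)) = fun _ => 0 := by
    simp [iteratedDeriv_succ, iteratedDeriv_zero]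
  rw [h]
  simp

lemma mem_lipschitzTwo_of_hasDerivAt {f f' f'' f''' : ℝ → ℝ} (h1 : ∀ x, HasDerivAt f (f' x) x)
    (h2 : ∀ x, HasDerivAt f' (f'' x) x) (h3 : ∀ x, HasDerivAt f'' (f''' x) x)
    (hf : ContDiff ℝ 2 f) (hb : ∀ x, |f''' x| ≤ 1) : f ∈ lipschitzTwo := by
  refine ⟨hf, fun x y => ?_⟩
  have e : iteratedDeriv 2 f = f'' := by
    rw [iteratedDeriv_succ, iteratedDeriv_one, show deriv f = f' from funext fun x => (h1 x).deriv]
    exact funext fun x => (h2 x).deriv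
  rw [e]
  have := Convex.norm_image_sub_le_of_norm_hasDerivWithin_le (s := Set.univ)
    (C := 1) (x := y) (y := x) (fun y _ => (h3 y).hasDerivWithinAt) (fun y _ => hb y)
    convex_univ trivial trivial
  simpa using this

lemma cos_mem_lipschitzTwo : Real.cos ∈ lipschitzTwo :=
  mem_lipschitzTwo_of_hasDerivAt (f''' := fun x => Real.sin x) Real.hasDerivAt_cos
    (fun x => (Real.hasDerivAt_sin x).fun_neg)
        (fun x => by simpa using (Real.hasDerivAt_cos x).fun_neg)
    Real.contDiff_cos Real.abs_sin_le_one

lemma sin_mem_lipschitzTwo : Real.sin ∈ lipschitzTwo :=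
  mem_lipschitzTwo_of_hasDerivAt (f''' := fun x => -Real.cos x) Real.hasDerivAt_sin
    Real.hasDerivAt_cos (fun x => (Real.hasDerivAt_sin x).fun_neg)
    Real.contDiff_sin (fun x => by rw [abs_neg]; exact Real.abs_cos_le_one x)

/-! ### Gaussian perturbation -/

lemma abs_integral_sub_integral_le {μ : Measure ℝ} {g p q : ℝ → ℝ} (hg : Integrable g μ)
    (hp : Integrable p μ) (hq : Integrable q μ) (H : ∀ x, |g x - p x| ≤ q x) :
    |∫ x, g x ∂μ - ∫ x, p x ∂μ| ≤ ∫ x, q x ∂μ := by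
  rw [← integral_sub hg hp]
  exact abs_integral_le_integral_abs.trans (integral_mono (hg.sub hp).abs hq H)

lemma integrable_abs_cube_gaussianReal (m : ℝ) (v : ℝ≥0) :
    Integrable (fun x => |x| ^ 3) (gaussianReal m v) := by
  have := (memLp_id_gaussianReal (μ := m) (v := v) 3).integrable_norm_pow (p := 3) (by norm_num)
  simpa using this

lemma CubicGrowth.integrable_gaussianReal {g : ℝ → ℝ} (hg : CubicGrowth g) (v : ℝ≥0) :
    Integrable g (gaussianReal 0 v) :=
  hg.integrable (integrable_abs_cube_gaussianReal 0 v)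

lemma integral_sq_gaussianReal (v : ℝ≥0) : ∫ x, x ^ 2 ∂gaussianReal 0 v = v := by
  rw [← variance_fun_id_gaussianReal (μ := 0) (v := v), variance_eq_integral (by fun_prop)]
  simp [integral_id_gaussianReal]

/-- The third absolute moment of the standard normal distribution. -/
noncomputable def gaussianCube : ℝ := ∫ x, |x| ^ 3 ∂gaussianReal 0 1

lemma gaussianCube_nonneg : 0 ≤ gaussianCube := integral_nonneg fun x => by
  dsimp only [Pi.zero_apply]; positivity

lemma gaussianReal_eq_map_sqrt (v : ℝ≥0) :
    gaussianReal 0 v = (gaussianReal 0 1).map (fun x => √(v : ℝ) * x) := by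
  rw [gaussianReal_map_const_mul]
  congr 1
  · simp
  · ext; simp

lemma integral_abs_cube_gaussianReal (v : ℝ≥0) :
    ∫ x, |x| ^ 3 ∂gaussianReal 0 v = gaussianCube * √(v : ℝ) ^ 3 := by
  rw [gaussianReal_eq_map_sqrt, integral_map (by fun_prop) (by fun_prop), gaussianCube, mul_comm,
    ← integral_const_mul]
  refine integral_congr_ae (ae_of_all _ fun x => ?_)
  dsimp only
  rw [abs_mul, mul_pow, abs_of_nonneg (Real.sqrt_nonneg _)]

lemma integral_abs_gaussianReal_le (v : ℝ≥0) :
    ∫ x, |x| ∂gaussianReal 0 v ≤ (1 + gaussianCube) * √(v : ℝ) := by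
  rw [gaussianReal_eq_map_sqrt, integral_map (by fun_prop) (by fun_prop)]
  simp_rw [abs_mul, abs_of_nonneg (Real.sqrt_nonneg _)]
  rw [integral_const_mul, mul_comm]
  gcongr
  have h1 : ∫ x, |x| ∂gaussianReal 0 1 ≤ ∫ x, (1 + |x| ^ 3) ∂gaussianReal 0 1 :=
    integral_mono (cubicGrowth_id.integrable_gaussianReal 1).abs
      ((integrable_const _).add (integrable_abs_cube_gaussianReal 0 1)) abs_le_one_add_cube
  rw [integral_add (integrable_const _) (integrable_abs_cube_gaussianReal 0 1)] at h1
  simpa [gaussianCube] using h1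

lemma CubicGrowth.integral_gaussianReal_add {g : ℝ → ℝ} (hg : CubicGrowth g) (u r : ℝ≥0) :
    ∫ x, g x ∂gaussianReal 0 (u + r)
      = ∫ w, ∫ x, g (x + w) ∂gaussianReal 0 u ∂gaussianReal 0 r := by
  have h : gaussianReal 0 (u + r) = gaussianReal 0 r ∗ gaussianReal 0 u := by
    rw [gaussianReal_conv_gaussianReal, add_comm u r, add_zero]
  have hi := hg.integrable_gaussianReal (u + r)
  rw [h] at hi ⊢
  rw [integral_conv hi]
  simp_rw [add_comm]

lemma CubicGrowth.integrable_integral_gaussianReal {g : ℝ → ℝ} (hg : CubicGrowth g) (u : ℝ≥0)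
    {μ : Measure ℝ} [IsFiniteMeasure μ] (hμ : Integrable (fun x => |x| ^ 3) μ) :
    Integrable (fun w => ∫ x, g (x + w) ∂gaussianReal 0 u) μ := by
  have := (hg.integrable_prod (integrable_abs_cube_gaussianReal 0 u) hμ 0).integral_prod_right
  simpa using this

lemma abs_add_cube_le (x y : ℝ) : |x + y| ^ 3 ≤ 9 * (|x| ^ 3 + |y| ^ 3) := by
  simpa using abs_add_add_cube_le x y 0

/-- The integrated Taylor expansion of `f` for a translation. -/
lemma abs_integral_taylor_le {f : ℝ → ℝ} (hf : f ∈ lipschitzTwo) (v : ℝ≥0) (w : ℝ) :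
    |∫ x, f (x + w) ∂gaussianReal 0 v - (∫ x, f x ∂gaussianReal 0 v
      + w * ∫ x, deriv f x ∂gaussianReal 0 v
      + w ^ 2 / 2 * ∫ x, iteratedDeriv 2 f x ∂gaussianReal 0 v)| ≤ |w| ^ 3 := by
  have i0 := (cubicGrowth_of_mem_lipschitzTwo hf).integrable_gaussianReal v
  have i1 := ((cubicGrowth_deriv hf).integrable_gaussianReal v).const_mul w
  have i2 := ((cubicGrowth_iteratedDeriv_two hf).integrable_gaussianReal v).const_mul (w ^ 2 / 2)
  have h := abs_integral_sub_integral_le (μ := gaussianReal 0 v)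
    (((cubicGrowth_of_mem_lipschitzTwo hf).comp_add w).integrable_gaussianReal v)
    ((i0.add i1).add i2) (integrable_const (|w| ^ 3)) (fun x => by
      have := abs_taylor_le_of_mem_lipschitzTwo hf x w
      simp only [Pi.add_apply]
      rwa [← sub_sub, ← sub_sub])
  rw [integral_add' (i0.add i1) i2, integral_add' i0 i1, integral_const_mul,
      integral_const_mul] at h
  simpa using h

lemma abs_integral_deriv_taylor_le {f : ℝ → ℝ} (hf : f ∈ lipschitzTwo) (v : ℝ≥0) (w : ℝ) :
    |∫ x, deriv f (x + w) ∂gaussianReal 0 v - (∫ x, deriv f x ∂gaussianReal 0 v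
      + w * ∫ x, iteratedDeriv 2 f x ∂gaussianReal 0 v)| ≤ w ^ 2 := by
  have i0 := (cubicGrowth_deriv hf).integrable_gaussianReal v
  have i1 := ((cubicGrowth_iteratedDeriv_two hf).integrable_gaussianReal v).const_mul w
  have h := abs_integral_sub_integral_le (μ := gaussianReal 0 v)
    (((cubicGrowth_deriv hf).comp_add w).integrable_gaussianReal v)
    (i0.add i1) (integrable_const (w ^ 2)) (fun x => by
      have := abs_deriv_sub_le_of_mem_lipschitzTwo hf x w
      simp only [Pi.add_apply]
      rwa [← sub_sub])
  rw [integral_add' i0 i1, integral_const_mul] at h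
  simpa using h

lemma abs_integral_iteratedDeriv_sub_le {f : ℝ → ℝ} (hf : f ∈ lipschitzTwo) (v : ℝ≥0) (w : ℝ) :
    |∫ x, iteratedDeriv 2 f (x + w) ∂gaussianReal 0 v
      - ∫ x, iteratedDeriv 2 f x ∂gaussianReal 0 v| ≤ |w| := by
  have h := abs_integral_sub_integral_le (μ := gaussianReal 0 v)
    (((cubicGrowth_iteratedDeriv_two hf).comp_add w).integrable_gaussianReal v)
    ((cubicGrowth_iteratedDeriv_two hf).integrable_gaussianReal v) (integrable_const |w|)
        (fun x => by
      simpa using hf.2 (x + w) x)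
  simpa using h

/-- Expansion under an increase of the variance of the Gaussian. -/
lemma abs_integral_gaussian_expansion_le {f : ℝ → ℝ} (hf : f ∈ lipschitzTwo) (v r : ℝ≥0) (b : ℝ) :
    |∫ x, f (x + b) ∂gaussianReal 0 (v + r) - (∫ x, f x ∂gaussianReal 0 v
      + b * ∫ x, deriv f x ∂gaussianReal 0 v
      + (b ^ 2 + r) / 2 * ∫ x, iteratedDeriv 2 f x ∂gaussianReal 0 v)|
      ≤ 9 * (gaussianCube * √(r : ℝ) ^ 3 + |b| ^ 3) := by
  have hb := comp_add_mem_lipschitzTwo hf b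
  have hg := cubicGrowth_of_mem_lipschitzTwo hb
  rw [hg.integral_gaussianReal_add]
  set F0 := ∫ x, f x ∂gaussianReal 0 v
  set F1 := ∫ x, deriv f x ∂gaussianReal 0 v
  set F2 := ∫ x, iteratedDeriv 2 f x ∂gaussianReal 0 v
  have hP : ∀ w : ℝ, F0 + (w + b) * F1 + (w + b) ^ 2 / 2 * F2
      = (F2 / 2) * w ^ 2 + ((F1 + b * F2) * w + (F0 + b * F1 + b ^ 2 / 2 * F2)) := by
    intro w; ring
  have j2 := (cubicGrowth_sq.integrable_gaussianReal r).const_mul (F2 / 2)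
  have j1 := (cubicGrowth_id.integrable_gaussianReal r).const_mul (F1 + b * F2)
  have j0 : Integrable (fun _ : ℝ => F0 + b * F1 + b ^ 2 / 2 * F2) (gaussianReal 0 r) :=
    integrable_const _
  have h := abs_integral_sub_integral_le (μ := gaussianReal 0 r)
    (hg.integrable_integral_gaussianReal v (integrable_abs_cube_gaussianReal 0 r))
    (j2.add (j1.add j0))
    (((integrable_abs_cube_gaussianReal 0 r).add (integrable_const (|b| ^ 3))).const_mul 9)
    (fun w => by
      have h1 := abs_integral_taylor_le hf v (w + b)
      simp only [Pi.add_apply]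
      rw [← hP]
      simp_rw [add_assoc]
      simp_rw [add_assoc] at h1
      exact h1.trans (abs_add_cube_le w b))
  rw [integral_add' j2 (j1.add j0), integral_add' j1 j0, integral_const_mul, integral_const_mul,
    integral_const_mul, integral_add' (integrable_abs_cube_gaussianReal 0 r) (integrable_const _),
    integral_sq_gaussianReal, integral_id_gaussianReal, integral_abs_cube_gaussianReal] at h
  simp only [integral_const, probReal_univ, one_smul] at h
  refine le_trans (le_of_eq ?_) h
  congr 2
  ring

lemma mul_sq_le_cube_add_cube {a c : ℝ} (ha : 0 ≤ a) (hc : 0 ≤ c) :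
    a * c ^ 2 ≤ a ^ 3 + c ^ 3 := by
  rcases le_total a c with h | h
  · have := mul_le_mul_of_nonneg_right h (sq_nonneg c)
    have := pow_nonneg ha 3
    linarith
  · have := mul_le_mul_of_nonneg_left (pow_le_pow_left₀ hc h 2) ha
    have := pow_nonneg hc 3
    linarith

/-- Comparison of a translated Gaussian with a Gaussian of another variance: the error of the second
order expansion is of third order, whichever of the two variances is larger. -/
lemma exists_gaussian_comparison : ∃ C, 0 ≤ C ∧ ∀ f ∈ lipschitzTwo, ∀ (u v : ℝ≥0) (b : ℝ),
    |∫ x, f (x + b) ∂gaussianReal 0 u - (∫ x, f x ∂gaussianReal 0 v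
      + b * ∫ x, deriv f x ∂gaussianReal 0 v
      + (b ^ 2 + u - v) / 2 * ∫ x, iteratedDeriv 2 f x ∂gaussianReal 0 v)|
      ≤ C * (|b| ^ 3 + √|(u : ℝ) - v| ^ 3) := by
  have hM := gaussianCube_nonneg
  refine ⟨20 * (1 + gaussianCube), by positivity, fun f hf u v b => ?_⟩
  rcases le_total v u with hvu | huv
  · obtain ⟨r, rfl⟩ := exists_add_of_le hvu
    have h := abs_integral_gaussian_expansion_le hf v r b
    have hr : √|((v + r : ℝ≥0) : ℝ) - v| = √(r : ℝ) := by
      push_cast; rw [add_sub_cancel_left, NNReal.abs_eq]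
    rw [hr]
    have e : (b ^ 2 + ((v + r : ℝ≥0) : ℝ) - v) / 2 = (b ^ 2 + r) / 2 := by push_cast; ring
    rw [e]
    refine h.trans ?_
    have h1 : 0 ≤ |b| ^ 3 := by positivity
    have h2 : 0 ≤ √(r : ℝ) ^ 3 := by positivity
    nlinarith [mul_nonneg hM h1, mul_nonneg hM h2]
  · obtain ⟨r, rfl⟩ := exists_add_of_le huv
    have hr : √|(u : ℝ) - ((u + r : ℝ≥0) : ℝ)| = √(r : ℝ) := by
      push_cast; rw [sub_add_cancel_left, abs_neg, NNReal.abs_eq]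
    rw [hr]
    set ρ := √(r : ℝ) with hρ
    have hρ0 : 0 ≤ ρ := Real.sqrt_nonneg _
    have hρ2 : ρ ^ 2 = r := Real.sq_sqrt r.2
    set G0 := ∫ x, f x ∂gaussianReal 0 u with hG0
    set G1 := ∫ x, deriv f x ∂gaussianReal 0 u with hG1
    set G2 := ∫ x, iteratedDeriv 2 f x ∂gaussianReal 0 u with hG2
    have hb0 := abs_integral_taylor_le hf u b
    have hc0 : |∫ x, f x ∂gaussianReal 0 (u + r) - (G0 + r / 2 * G2)| ≤ 9 *
        (gaussianCube * ρ ^ 3) := by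
      have := abs_integral_gaussian_expansion_le hf u r 0
      simpa using this
    have hc1 : |∫ x, deriv f x ∂gaussianReal 0 (u + r) - G1| ≤ ρ ^ 2 := by
      have hg := cubicGrowth_deriv hf
      rw [hg.integral_gaussianReal_add]
      have j1 := (cubicGrowth_id.integrable_gaussianReal r).mul_const G2
      have h := abs_integral_sub_integral_le (μ := gaussianReal 0 r)
        (hg.integrable_integral_gaussianReal u (integrable_abs_cube_gaussianReal 0 r))
        ((integrable_const G1).add j1) (cubicGrowth_sq.integrable_gaussianReal r)
        (fun w => abs_integral_deriv_taylor_le hf u w)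
      rw [integral_add' (integrable_const _) j1, integral_mul_const, integral_id_gaussianReal,
        integral_sq_gaussianReal] at h
      simpa [hρ2] using h
    have hc2 : |∫ x, iteratedDeriv 2 f x ∂gaussianReal 0 (u + r) - G2|
        ≤ (1 + gaussianCube) * ρ := by
      have hg := cubicGrowth_iteratedDeriv_two hf
      rw [hg.integral_gaussianReal_add]
      have h := abs_integral_sub_integral_le (μ := gaussianReal 0 r)
        (hg.integrable_integral_gaussianReal u (integrable_abs_cube_gaussianReal 0 r))
        (integrable_const G2) (cubicGrowth_id.integrable_gaussianReal r).abs
        (fun w => abs_integral_iteratedDeriv_sub_le hf u w)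
      simp only [integral_const, probReal_univ, one_smul] at h
      exact h.trans (integral_abs_gaussianReal_le r)
    set F0 := ∫ x, f x ∂gaussianReal 0 (u + r)
    set F1 := ∫ x, deriv f x ∂gaussianReal 0 (u + r)
    set F2 := ∫ x, iteratedDeriv 2 f x ∂gaussianReal 0 (u + r)
    set X := ∫ x, f (x + b) ∂gaussianReal 0 u
    have e : X - (F0 + b * F1 + (b ^ 2 + u - ((u + r : ℝ≥0) : ℝ)) / 2 * F2)
        = (X - (G0 + b * G1 + b ^ 2 / 2 * G2)) - (F0 - (G0 + r / 2 * G2)) - b * (F1 - G1)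
          - (b ^ 2 - ρ ^ 2) / 2 * (F2 - G2) := by
      rw [hρ2]; push_cast; ring
    rw [e]
    have t1 : |b * (F1 - G1)| ≤ |b| ^ 3 + ρ ^ 3 := by
      rw [abs_mul]
      have h1 : |b| * |F1 - G1| ≤ |b| * ρ ^ 2 := by gcongr
      exact h1.trans (mul_sq_le_cube_add_cube (abs_nonneg b) hρ0)
    have t2 : |(b ^ 2 - ρ ^ 2) / 2 * (F2 - G2)| ≤ (1 + gaussianCube) * (|b| ^ 3 + ρ ^ 3) := by
      rw [abs_mul]
      have hb := abs_nonneg b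
      have h0 : |(b ^ 2 - ρ ^ 2) / 2| ≤ (|b| ^ 2 + ρ ^ 2) / 2 := by
        rw [sq_abs, abs_le]
        constructor <;> nlinarith [sq_nonneg b, sq_nonneg ρ]
      have h1 : |(b ^ 2 - ρ ^ 2) / 2| * |F2 - G2|
          ≤ (|b| ^ 2 + ρ ^ 2) / 2 * ((1 + gaussianCube) * ρ) := by gcongr
      have h2 : (|b| ^ 2 + ρ ^ 2) / 2 * ρ ≤ |b| ^ 3 + ρ ^ 3 := by
        have h3 := mul_sq_le_cube_add_cube hρ0 hb
        have h4 := pow_nonneg hb 3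
        linarith
      have h3 := mul_le_mul_of_nonneg_left h2 (by positivity : 0 ≤ 1 + gaussianCube)
      linarith
    have s1 := abs_sub (X - (G0 + b * G1 + b ^ 2 / 2 * G2) - (F0 - (G0 + r / 2 * G2)) - b *
        (F1 - G1))
      ((b ^ 2 - ρ ^ 2) / 2 * (F2 - G2))
    have s2 := abs_sub (X - (G0 + b * G1 + b ^ 2 / 2 * G2) - (F0 - (G0 + r / 2 * G2))) (b *
        (F1 - G1))
    have s3 := abs_sub (X - (G0 + b * G1 + b ^ 2 / 2 * G2)) (F0 - (G0 + r / 2 * G2))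
    have p1 : 0 ≤ |b| ^ 3 := by positivity
    have p2 : 0 ≤ ρ ^ 3 := by positivity
    have p3 := mul_nonneg hM p1
    have p4 := mul_nonneg hM p2
    linarith

/-! ### The Zolotarev distance to the Gaussian of equal variance -/

/-- The Zolotarev distance between the centred number of rounds and the centred Gaussian with the
same variance, as a real supremum (it is finite by `IsRoundsLaw.bddAbove_gaussianDist`). -/
noncomputable def gaussianDist (ν : ℕ → Measure ℝ) (n : ℕ) : ℝ :=
  ⨆ f : lipschitzTwo, |∫ x, f.1 (x - meanRounds ν n) ∂ν n
    - ∫ x, f.1 x ∂gaussianReal 0 (varRounds ν n).toNNReal|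

section

variable {ν : ℕ → Measure ℝ} (h : IsRoundsLaw ν)
include h

lemma IsRoundsLaw.bddAbove_gaussianDist (n : ℕ) : BddAbove (Set.range fun f : lipschitzTwo =>
    |∫ x, f.1 (x - meanRounds ν n) ∂ν n
      - ∫ x, f.1 x ∂gaussianReal 0 (varRounds ν n).toNNReal|) := by
  have hprob := h.prob n
  set m := meanRounds ν n with hm
  set v := (varRounds ν n).toNNReal with hv
  refine ⟨∫ x, |x + (-m)| ^ 3 ∂ν n + ∫ x, |x| ^ 3 ∂gaussianReal 0 v, ?_⟩
  rintro _ ⟨⟨f, hf⟩, rfl⟩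
  -- both integrals are compared with the integral of the second Taylor polynomial of `f` at `0`,
  -- which depends on the first two moments only
  set q : ℝ → ℝ := fun x => f 0 + x * deriv f 0 + x ^ 2 / 2 * iteratedDeriv 2 f 0 with hq
  have hqf : ∀ x, |f x - q x| ≤ |x| ^ 3 := fun x => by
    have := abs_taylor_le_of_mem_lipschitzTwo hf 0 x
    rw [zero_add] at this
    simp only [hq]
    rwa [← sub_sub, ← sub_sub]
  have hqi : ∀ x, q x = (iteratedDeriv 2 f 0 / 2) * x ^ 2 + (deriv f 0 * x + f 0) := by
    intro x; simp only [hq]; ring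
  have hqg : CubicGrowth q := by
    rw [funext hqi]
    exact (cubicGrowth_sq.const_mul _).add ((cubicGrowth_id.const_mul _).add (CubicGrowth.const _))
  have hf' := cubicGrowth_of_mem_lipschitzTwo hf
  have h1 := abs_integral_sub_integral_le (h.integrable (hf'.comp_add (-m)) n)
    (h.integrable (hqg.comp_add (-m)) n) (h.integrable (cubicGrowth_abs_cube.comp_add (-m)) n)
    (fun x => hqf (x + (-m)))
  have h2 := abs_integral_sub_integral_le (hf'.integrable_gaussianReal v)
    (hqg.integrable_gaussianReal v) (integrable_abs_cube_gaussianReal 0 v) hqf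
  have h3 : ∫ x, q (x + (-m)) ∂ν n = ∫ x, q x ∂gaussianReal 0 v := by
    have j1 := (cubicGrowth_sq.integrable_gaussianReal v).const_mul (iteratedDeriv 2 f 0 / 2)
    have j2 := (cubicGrowth_id.integrable_gaussianReal v).const_mul (deriv f 0)
    have k1 := (h.integrable (cubicGrowth_sq.comp_add (-m)) n).const_mul (iteratedDeriv 2 f 0 / 2)
    have k2 := (h.integrable (cubicGrowth_id.comp_add (-m)) n).const_mul (deriv f 0)
    simp_rw [hqi]
    rw [integral_add j1 (by exact j2.add (integrable_const _)), integral_add j2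
        (integrable_const _),
      integral_add k1 (by exact k2.add (integrable_const _)), integral_add k2 (integrable_const _)]
    rw [integral_const_mul, integral_const_mul, integral_const_mul, integral_const_mul,
      integral_sq_gaussianReal, integral_id_gaussianReal, h.integral_add_const,
      h.integral_add_const_sq, hv, Real.coe_toNNReal _ (varRounds_nonneg ν n), ← hm]
    simp
  rw [h3] at h1
  simp only [sub_eq_add_neg _ m]
  have := abs_sub_le (∫ x, f (x + -m) ∂ν n) (∫ x, q x ∂gaussianReal 0 v)
    (∫ x, f x ∂gaussianReal 0 v)
  rw [abs_sub_comm (∫ x, q x ∂gaussianReal 0 v)] at this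
  linarith

lemma IsRoundsLaw.abs_integral_sub_le_gaussianDist {f : ℝ → ℝ} (hf : f ∈ lipschitzTwo) (n : ℕ) :
    |∫ x, f (x - meanRounds ν n) ∂ν n - ∫ x, f x ∂gaussianReal 0 (varRounds ν n).toNNReal|
      ≤ gaussianDist ν n :=
  le_ciSup (h.bddAbove_gaussianDist n) ⟨f, hf⟩

lemma IsRoundsLaw.gaussianDist_nonneg (n : ℕ) : 0 ≤ gaussianDist ν n :=
  (abs_nonneg _).trans (h.abs_integral_sub_le_gaussianDist zero_mem_lipschitzTwo n)

lemma IsRoundsLaw.abs_integral_comp_mul_sub_le {f : ℝ → ℝ} (hf : f ∈ lipschitzTwo) (n : ℕ) (c : ℝ) :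
    |∫ x, f (c * (x - meanRounds ν n)) ∂ν n
      - ∫ x, f (c * x) ∂gaussianReal 0 (varRounds ν n).toNNReal| ≤ |c| ^ 3 * gaussianDist ν n := by
  rcases eq_or_ne c 0 with rfl | hc
  · have := h.prob n
    simp
  · have h1 := h.abs_integral_sub_le_gaussianDist (smul_comp_mul_mem_lipschitzTwo hf hc) n
    rw [integral_const_mul, integral_const_mul, ← mul_sub, abs_mul,
      abs_of_nonneg (by positivity : 0 ≤ (|c| ^ 3)⁻¹)] at h1
    have hc' : 0 < |c| ^ 3 := by have := abs_pos.2 hc; positivity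
    rwa [inv_mul_le_iff₀ hc'] at h1

lemma IsRoundsLaw.exists_abs_meanRounds_sub_le : ∃ A, 0 ≤ A ∧ ∀ n, ∀ j ≤ n,
    |meanRounds ν j - meanRounds ν n| ≤ A * |(harmonic n : ℝ) - harmonic j| := by
  obtain ⟨A, hA0, hA⟩ := h.exists_mean_increment_le
  refine ⟨A, hA0, fun n j hj => ?_⟩
  have hmono : (harmonic j : ℝ) ≤ harmonic n := harmonic_mono hj
  rw [abs_of_nonneg (sub_nonneg.2 hmono)]
  clear hmono
  induction n, hj using Nat.le_induction with
  | base => simp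
  | succ n hn ih =>
    have h1 := abs_sub_le (meanRounds ν j) (meanRounds ν n) (meanRounds ν (n + 1))
    have h2 := hA n
    rw [abs_sub_comm] at h2
    rw [harmonic_succ]
    push_cast
    rw [show A * ((harmonic n : ℝ) + ((n : ℝ) + 1)⁻¹ - harmonic j)
      = A * ((harmonic n : ℝ) - harmonic j) + A / ((n : ℝ) + 1) by ring]
    linarith

/-- The conditional contribution of the pair `(j, k)` of subproblem sizes: the number of rounds of
the first subproblem is replaced by a Gaussian, and the remaining summands are absorbed by the
comparison of Gaussians. -/
lemma IsRoundsLaw.abs_integral_step_sub_le {C : ℝ} (hC : ∀ f ∈ lipschitzTwo, ∀ (u v : ℝ≥0) (b : ℝ),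
    |∫ x, f (x + b) ∂gaussianReal 0 u - (∫ x, f x ∂gaussianReal 0 v
      + b * ∫ x, deriv f x ∂gaussianReal 0 v
      + (b ^ 2 + u - v) / 2 * ∫ x, iteratedDeriv 2 f x ∂gaussianReal 0 v)|
      ≤ C * (|b| ^ 3 + √|(u : ℝ) - v| ^ 3)) (hC0 : 0 ≤ C) {f : ℝ → ℝ} (hf : f ∈ lipschitzTwo)
    (n j k : ℕ) :
    |∫ y, ∫ x, f (x + y + 1 - meanRounds ν n) ∂ν j ∂ν k
      - (∫ x, f x ∂gaussianReal 0 (varRounds ν n).toNNReal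
        + (meanRounds ν j + meanRounds ν k + 1 - meanRounds ν n)
          * ∫ x, deriv f x ∂gaussianReal 0 (varRounds ν n).toNNReal
        + ((varRounds ν j + varRounds ν k
            + (meanRounds ν j + meanRounds ν k + 1 - meanRounds ν n) ^ 2) - varRounds ν n) / 2
          * ∫ x, iteratedDeriv 2 f x ∂gaussianReal 0 (varRounds ν n).toNNReal)|
    ≤ gaussianDist ν j + C * (9 * (|meanRounds ν j - meanRounds ν n| ^ 3 + ∫ y, |y| ^ 3 ∂ν k + 1)
      + (1 + |varRounds ν j - varRounds ν n| ^ 3)) := by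
  have hprob := h.prob
  set m := meanRounds ν
  set v := (varRounds ν n).toNNReal with hv
  set u := (varRounds ν j).toNNReal with hu
  have hv' : (v : ℝ) = varRounds ν n := Real.coe_toNNReal _ (varRounds_nonneg ν n)
  have hu' : (u : ℝ) = varRounds ν j := Real.coe_toNNReal _ (varRounds_nonneg ν j)
  set F0 := ∫ x, f x ∂gaussianReal 0 v
  set F1 := ∫ x, deriv f x ∂gaussianReal 0 v
  set F2 := ∫ x, iteratedDeriv 2 f x ∂gaussianReal 0 v
  set c := m j + 1 - m n with hc
  have hf' := cubicGrowth_of_mem_lipschitzTwo hf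
  have hroot : √|(u : ℝ) - v| ^ 3 ≤ 1 + |varRounds ν j - varRounds ν n| ^ 3 := by
    rw [hu', hv']
    set d := |varRounds ν j - varRounds ν n|
    have hd : 0 ≤ d := abs_nonneg _
    rcases le_total d 1 with h1 | h1
    · have := pow_le_one₀ (n := 3) (Real.sqrt_nonneg d) (Real.sqrt_le_one.2 h1)
      have := pow_nonneg hd 3
      linarith
    · have h2 : √d ≤ d := (Real.sqrt_le_left hd).2 (by nlinarith)
      have := pow_le_pow_left₀ (Real.sqrt_nonneg d) h2 3
      linarith
  have hpt : ∀ y : ℝ, |∫ x, f (x + y + 1 - m n) ∂ν j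
      - ((F2 / 2) * (y + c) ^ 2 + (F1 * (y + c) + (F0 + (varRounds ν j - varRounds ν n) / 2 * F2)))|
      ≤ gaussianDist ν j + C * (9 * (|m j - m n| ^ 3 + |y| ^ 3 + 1)
        + (1 + |varRounds ν j - varRounds ν n| ^ 3)) := by
    intro y
    have h1 := h.abs_integral_sub_le_gaussianDist (comp_add_mem_lipschitzTwo hf (y + c)) j
    have e1 : ∀ x, x - m j + (y + c) = x + y + 1 - m n := fun x => by rw [hc]; ring
    simp only [show meanRounds ν = m from rfl, e1] at h1
    have h2 := hC f hf u v (y + c)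
    have h3 := abs_sub_le (∫ x, f (x + y + 1 - m n) ∂ν j) (∫ x, f (x + (y + c)) ∂gaussianReal 0 u)
      ((F2 / 2) * (y + c) ^ 2 + (F1 * (y + c) + (F0 + (varRounds ν j - varRounds ν n) / 2 * F2)))
    have e2 : (F2 / 2) * (y + c) ^ 2 + (F1 * (y + c) + (F0 +
        (varRounds ν j - varRounds ν n) / 2 * F2))
        = F0 + (y + c) * F1 + ((y + c) ^ 2 + u - v) / 2 * F2 := by rw [hu', hv']; ring
    rw [e2] at h3 ⊢
    have h4 : |y + c| ^ 3 ≤ 9 * (|m j - m n| ^ 3 + |y| ^ 3 + 1) := by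
      have := abs_add_add_cube_le (m j - m n) y 1
      rw [show m j - m n + y + 1 = y + c by rw [hc]; ring] at this
      simpa using this
    have h5 : C * (|y + c| ^ 3 + √|(u : ℝ) - v| ^ 3) ≤ C * (9 * (|m j - m n| ^ 3 + |y| ^ 3 + 1)
        + (1 + |varRounds ν j - varRounds ν n| ^ 3)) := by gcongr
    linarith
  have i0 : Integrable (fun y => ∫ x, f (x + y + 1 - m n) ∂ν j) (ν k) := by
    have := ((hf'.integrable_prod (h.integrable_abs_cube j) (h.integrable_abs_cube k)
      (1 - m n))).integral_prod_right
    simpa only [add_sub_assoc] using this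
  have i1 := (h.integrable (cubicGrowth_sq.comp_add c) k).const_mul (F2 / 2)
  have i2 := (h.integrable (cubicGrowth_id.comp_add c) k).const_mul F1
  have i3 : Integrable (fun y => F1 * (y + c) + (F0 + (varRounds ν j - varRounds ν n) / 2 * F2))
      (ν k) :=
    i2.add (integrable_const _)
  set a := |m j - m n| ^ 3
  set b := |varRounds ν j - varRounds ν n| ^ 3
  have hcub := h.integrable_abs_cube k
  have hq : ∀ y : ℝ, gaussianDist ν j + C * (9 * (a + |y| ^ 3 + 1) + (1 + b))
      = (9 * C) * |y| ^ 3 + (gaussianDist ν j + C * (9 * (a + 1) + (1 + b))) := fun y => by ring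
  have i5 : Integrable (fun y : ℝ => gaussianDist ν j + C * (9 * (a + |y| ^ 3 + 1) + (1 + b)))
      (ν k) := by
    simp_rw [hq]
    exact (hcub.const_mul _).add (integrable_const _)
  have hfin := abs_integral_sub_integral_le i0 (i1.add i3) i5 hpt
  rw [integral_add' i1 i3, integral_add i2 (integrable_const _), integral_const_mul,
    integral_const_mul, h.integral_add_const_sq, h.integral_add_const] at hfin
  simp_rw [hq] at hfin
  rw [integral_add (hcub.const_mul _) (integrable_const _), integral_const_mul] at hfin
  simp only [integral_const, probReal_univ, one_smul] at hfin
  refine le_trans (le_of_eq ?_) (hfin.trans (le_of_eq (by ring)))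
  congr 2
  rw [show meanRounds ν k = m k from rfl, hc]
  ring

/-- The recursive inequality for the distances, in which the error added in one step is bounded. -/
lemma IsRoundsLaw.exists_gaussianDist_le_binomMean : ∃ K, 0 ≤ K ∧ ∀ n ≥ 2,
    gaussianDist ν n ≤ binomMean (gaussianDist ν) n + K := by
  obtain ⟨C, hC0, hC⟩ := exists_gaussian_comparison
  obtain ⟨A, hA0, hA⟩ := h.exists_abs_meanRounds_sub_le
  obtain ⟨K, hK0, hK⟩ := h.exists_moment_bounds
  obtain ⟨σ, hσ0, M, hM⟩ := h.exists_variance_asymptotics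
  have hM0 : 0 ≤ M := (abs_nonneg _).trans (hM 0)
  refine ⟨C * (9 * (A ^ 3 * 54 + K * 3 + 1) + (1 + 9 * (σ ^ 3 * 54 + (2 * M) ^ 3))),
    by positivity, fun n hn => ?_⟩
  set m := meanRounds ν
  set u : ℕ → ℝ := fun k => ∫ y, |y| ^ 3 ∂ν k with hu
  have : Nonempty lipschitzTwo := ⟨⟨_, zero_mem_lipschitzTwo⟩⟩
  refine ciSup_le fun ⟨f, hf⟩ => ?_
  set F0 := ∫ x, f x ∂gaussianReal 0 (varRounds ν n).toNNReal with hF0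
  set F1 := ∫ x, deriv f x ∂gaussianReal 0 (varRounds ν n).toNNReal
  set F2 := ∫ x, iteratedDeriv 2 f x ∂gaussianReal 0 (varRounds ν n).toNNReal
  have hrec := h.integral_eq (g := fun x => f (x - m n))
    ((cubicGrowth_of_mem_lipschitzTwo hf).comp_add (-m n)) hn
  -- the first and second order terms average to zero, as means and variances agree
  have hzero : F0 = splitMean n fun j k => F0 + (m j + m k + 1 - m n) * F1
      + ((varRounds ν j + varRounds ν k + (m j + m k + 1 - m n) ^ 2) - varRounds ν n) / 2 * F2 := by
    have e1 : splitMean n (fun j k => F0 + (m j + m k + 1 - m n) * F1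
      + ((varRounds ν j + varRounds ν k + (m j + m k + 1 - m n) ^ 2) - varRounds ν n) / 2 * F2)
      = splitMean n (fun j k => F0 + F1 * (m j + m k + 1 - m n)
      + F2 / 2 * ((varRounds ν j + varRounds ν k + (m j + m k + 1 - m n) ^ 2) - varRounds ν n)) :=
      splitMean_congr fun j _ k _ => by ring
    rw [e1, splitMean_add, splitMean_add, splitMean_const_mul, splitMean_const_mul, splitMean_sub,
      splitMean_sub, ← h.varRounds_eq hn, splitMean_add, splitMean_add]
    simp only [splitMean_const, splitMean_left n m, splitMean_right n m]
    have := h.meanRounds_eq hn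
    rw [show meanRounds ν = m from rfl] at this
    rw [← this]
    ring
  rw [hrec]
  conv_lhs => rw [hzero]
  rw [← splitMean_sub]
  have hb1 : binomMean (fun j => |m j - m n| ^ 3) n ≤ A ^ 3 * 54 := by
    refine (binomMean_mono (h := fun j => A ^ 3 * |(harmonic n : ℝ) - harmonic j| ^ 3)
      fun j hj => ?_).trans ?_
    · rw [← mul_pow]; exact pow_le_pow_left₀ (abs_nonneg _) (hA n j hj) 3
    · rw [binomMean_const_mul]
      gcongr
      exact binomMean_harmonic_sub_cube_le n
  have hb2 : geomMean u n ≤ K * 3 := by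
    have h1 : ∀ k, u k ≤ K * (3 / 2 : ℝ) ^ k := fun k => (le_abs_self _).trans (hK k).2.2.2
    refine (geomMean_mono (h1 0) fun k _ => h1 k).trans ?_
    rw [geomMean_const_mul]
    gcongr
    exact geomMean_three_halves_pow_le n
  have hb3 : binomMean (fun j => |varRounds ν j - varRounds ν n| ^ 3) n
      ≤ 9 * (σ ^ 3 * 54 + (2 * M) ^ 3) := by
    refine (binomMean_mono (h := fun j => 9 * (σ ^ 3 * |(harmonic n : ℝ) - harmonic j| ^ 3
      + (2 * M) ^ 3)) fun j hj => ?_).trans ?_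
    · have h1 : |varRounds ν j - varRounds ν n|
          ≤ |σ * |(harmonic n : ℝ) - harmonic j| + 2 * M| := by
        rw [abs_of_nonneg (a := σ * |(harmonic n : ℝ) - harmonic j| + 2 * M) (by positivity)]
        have h2 := hM j
        have h3 := hM n
        have h4 := abs_sub_le (varRounds ν j) (σ * harmonic j) (varRounds ν n)
        have h5 := abs_sub_le (σ * harmonic j) (σ * harmonic n) (varRounds ν n)
        rw [← mul_sub, abs_mul, abs_of_pos hσ0, abs_sub_comm (harmonic j : ℝ),
          abs_sub_comm (σ * (harmonic n : ℝ))] at h5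
        linarith
      refine (pow_le_pow_left₀ (abs_nonneg _) h1 3).trans ((abs_add_cube_le _ _).trans ?_)
      rw [abs_mul, abs_abs, abs_of_pos hσ0, abs_of_nonneg (by positivity : 0 ≤ 2 * M), mul_pow σ]
    · rw [binomMean_const_mul, binomMean_add, binomMean_const, binomMean_const_mul]
      gcongr
      exact binomMean_harmonic_sub_cube_le n
  calc _ ≤ splitMean n (fun j k => gaussianDist ν j
        + C * (9 * (|m j - m n| ^ 3 + u k + 1) + (1 + |varRounds ν j - varRounds ν n| ^ 3))) :=
        (abs_splitMean_le _ _).trans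
          (splitMean_mono fun j _ k _ => h.abs_integral_step_sub_le hC hC0 hf n j k)
    _ = binomMean (gaussianDist ν) n + C * (9 * (binomMean (fun j => |m j - m n| ^ 3) n
        + geomMean u n + 1)
        + (1 + binomMean (fun j => |varRounds ν j - varRounds ν n| ^ 3) n)) := by
        simp only [splitMean_add, splitMean_const_mul, splitMean_const,
          splitMean_left n (gaussianDist ν), splitMean_right n u,
          splitMean_left n (fun j => |m j - m n| ^ 3),
          splitMean_left n (fun j => |varRounds ν j - varRounds ν n| ^ 3)]
    _ ≤ _ := by gcongr

/-- The distances grow at most logarithmically. -/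
theorem IsRoundsLaw.exists_gaussianDist_le : ∃ D K, 0 ≤ D ∧ 0 ≤ K ∧ ∀ n,
    gaussianDist ν n ≤ D + K * harmonic n := by
  obtain ⟨K, hK0, hK⟩ := h.exists_gaussianDist_le_binomMean
  have h0 := h.gaussianDist_nonneg 0
  have h1 := h.gaussianDist_nonneg 1
  refine ⟨gaussianDist ν 0 + gaussianDist ν 1, 2 * K, by positivity, by positivity, fun n => ?_⟩
  refine le_of_binomMean_le (θ := 1) (n₀ := 2) zero_le_one (by norm_num) (ε := fun _ => K)
    (x := gaussianDist ν) (w := fun n => gaussianDist ν 0 + gaussianDist ν 1 + 2 * K * harmonic n)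
    ?_ (fun n hn => by simpa using hK n hn) ?_ n
  · intro j hj
    have : (0 : ℝ) ≤ harmonic j := by
      have := harmonic_mono (Nat.zero_le j)
      simpa using this
    have : 0 ≤ 2 * K * harmonic j := by positivity
    interval_cases j <;> linarith
  · intro n hn
    rw [binomMean_add, binomMean_const, binomMean_const_mul]
    have := mul_le_mul_of_nonneg_left (binomMean_harmonic_le (n := n) (by omega)) hK0
    linarith

end

/-! ### Normalization -/

section

variable {ν : ℕ → Measure ℝ} (h : IsRoundsLaw ν)
include h

/-- The asymptotics of the variance and the bound for the distance, in terms of `log n`. -/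
lemma IsRoundsLaw.exists_log_bounds : ∃ σ, 0 < σ ∧ ∃ M D K, 0 ≤ D ∧ 0 ≤ K ∧ ∀ n ≥ 1,
    |varRounds ν n - σ * Real.log n| ≤ M ∧ gaussianDist ν n ≤ D + K * Real.log n := by
  obtain ⟨σ, hσ, M, hM⟩ := h.exists_variance_asymptotics
  obtain ⟨D, K, hD, hK, hDK⟩ := h.exists_gaussianDist_le
  refine ⟨σ, hσ, M + σ, D + K, K, by positivity, hK, fun n hn => ?_⟩
  have h1 : (harmonic n : ℝ) ≤ 1 + Real.log n := harmonic_le_one_add_log n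
  have h2 : Real.log n ≤ harmonic n := by
    have := log_add_one_le_harmonic n
    have h3 : Real.log n ≤ Real.log ((n + 1 : ℕ) : ℝ) :=
      Real.log_le_log (by exact_mod_cast hn) (by push_cast; linarith)
    linarith
  constructor
  · have h3 := hM n
    rw [abs_le] at h3 ⊢
    have h4 := mul_le_mul_of_nonneg_left h1 hσ.le
    have h5 := mul_le_mul_of_nonneg_left h2 hσ.le
    constructor <;> linarith
  · have h3 := hDK n
    have h4 := mul_le_mul_of_nonneg_left h1 hK
    linarith

/-- The centred number of rounds, divided by its standard deviation, is within `O(1 / √(log n))` of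
the standard normal distribution. -/
theorem IsRoundsLaw.exists_zolotarev3_le : ∃ K : ℝ, ∀ᶠ n : ℕ in atTop,
    zolotarev3 ((ν n).map fun x => (x - meanRounds ν n) / √(varRounds ν n)) (gaussianReal 0 1)
      ≤ ENNReal.ofReal (K / √(Real.log n)) := by
  obtain ⟨σ, hσ, M, D, K, hD, hK, hb⟩ := h.exists_log_bounds
  refine ⟨(D + K) / √(σ / 2) ^ 3, ?_⟩
  have hlog : Tendsto (fun n : ℕ => Real.log n) atTop atTop :=
    Real.tendsto_log_atTop.comp tendsto_natCast_atTop_atTop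
  filter_upwards [hlog.eventually_ge_atTop 1, hlog.eventually_ge_atTop (2 * M / σ),
    eventually_ge_atTop 1] with n hn1 hn2 hn
  obtain ⟨hv, hd⟩ := hb n hn
  set l := Real.log n
  set s := varRounds ν n with hs
  have hs1 : σ / 2 * l ≤ s := by
    have h1 := (abs_le.1 hv).1
    rw [div_le_iff₀ hσ] at hn2
    linarith
  have hs0 : 0 < s := lt_of_lt_of_le (by positivity) hs1
  have hroot : 0 < √s := Real.sqrt_pos.2 hs0
  refine iSup₂_le fun f hf => ENNReal.ofReal_le_ofReal ?_
  have e1 : ∫ x, f x ∂(ν n).map (fun x => (x - meanRounds ν n) / √s)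
      = ∫ x, f ((√s)⁻¹ * (x - meanRounds ν n)) ∂ν n := by
    rw [integral_map (by fun_prop) hf.1.continuous.aestronglyMeasurable]
    simp_rw [div_eq_inv_mul]
  have e2 : ∫ x, f x ∂gaussianReal 0 1 = ∫ x, f ((√s)⁻¹ * x) ∂gaussianReal 0 s.toNNReal := by
    have hfc : Continuous fun x => f ((√s)⁻¹ * x) := hf.1.continuous.comp (by fun_prop)
    rw [gaussianReal_eq_map_sqrt s.toNNReal, integral_map (by fun_prop) hfc.aestronglyMeasurable,
        Real.coe_toNNReal _ hs0.le]
    simp_rw [inv_mul_cancel_left₀ hroot.ne']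
  rw [e1, e2]
  refine (h.abs_integral_comp_mul_sub_le hf n _).trans ?_
  rw [abs_of_pos (inv_pos.2 hroot), inv_pow, inv_mul_eq_div]
  have h1 : gaussianDist ν n ≤ (D + K) * l := by
    have := mul_le_mul_of_nonneg_left hn1 hD
    linarith
  have h2 : √(σ / 2) * √l ≤ √s := by
    rw [← Real.sqrt_mul (by positivity)]
    exact Real.sqrt_le_sqrt hs1
  have hl : 0 < √l := Real.sqrt_pos.2 (by linarith)
  have hσ' : 0 < √(σ / 2) := Real.sqrt_pos.2 (by positivity)
  calc gaussianDist ν n / √s ^ 3 ≤ (D + K) * l / (√(σ / 2) * √l) ^ 3 := by gcongr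
    _ = (D + K) * (√l ^ 2) / (√(σ / 2) * √l) ^ 3 := by rw [Real.sq_sqrt (by linarith)]
    _ = _ := by field_simp

omit h in
lemma charFun_eq_integral_cos_add {μ : Measure ℝ} [IsFiniteMeasure μ] (t : ℝ) :
    charFun μ t = ((∫ x, Real.cos (t * x) ∂μ : ℝ) : ℂ) + ((∫ x, Real.sin
        (t * x) ∂μ : ℝ) : ℂ) * Complex.I := by
  have h1 : Integrable (fun x => Real.cos (t * x)) μ :=
    Integrable.of_bound (by fun_prop) 1 (ae_of_all _ fun x => Real.abs_cos_le_one _)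
  have h2 : Integrable (fun x => Real.sin (t * x)) μ :=
    Integrable.of_bound (by fun_prop) 1 (ae_of_all _ fun x => Real.abs_sin_le_one _)
  rw [charFun_apply_real, ← integral_complex_ofReal, ← integral_complex_ofReal,
      ← integral_mul_const,
    ← integral_add h1.ofReal (h2.ofReal.mul_const _)]
  refine integral_congr_ae (ae_of_all _ fun x => ?_)
  dsimp only
  rw [Complex.exp_mul_I]
  push_cast
  rfl

lemma IsRoundsLaw.norm_charFun_sub_le (n : ℕ) (t : ℝ) :
    ‖charFun ((ν n).map fun x => x - meanRounds ν n) t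
      - charFun (gaussianReal 0 (varRounds ν n).toNNReal) t‖ ≤ 2 * |t| ^ 3 * gaussianDist ν n := by
  have hprob := h.prob n
  have : IsProbabilityMeasure ((ν n).map fun x => x - meanRounds ν n) :=
    Measure.isProbabilityMeasure_map (by fun_prop)
  have hc := h.abs_integral_comp_mul_sub_le cos_mem_lipschitzTwo n t
  have hs := h.abs_integral_comp_mul_sub_le sin_mem_lipschitzTwo n t
  rw [charFun_eq_integral_cos_add, charFun_eq_integral_cos_add,
    integral_map (by fun_prop) (by fun_prop), integral_map (by fun_prop) (by fun_prop)]
  rw [add_sub_add_comm, ← sub_mul, ← Complex.ofReal_sub, ← Complex.ofReal_sub]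
  refine (norm_add_le _ _).trans ?_
  rw [norm_mul, Complex.norm_I, mul_one, Complex.norm_real, Complex.norm_real, Real.norm_eq_abs,
    Real.norm_eq_abs]
  linarith

/-- The characteristic functions of the normalized laws converge to that of the standard normal
distribution. -/
theorem IsRoundsLaw.exists_tendsto_charFun : ∃ C : ℝ, 0 < C ∧ ∀ t : ℝ, Tendsto (fun n : ℕ =>
    charFun ((ν n).map fun x => (x - meanRounds ν n) / (√C * √(Real.log n))) t) atTop
      (𝓝 (charFun (gaussianReal 0 1) t)) := by
  obtain ⟨σ, hσ, M, D, K, hD, hK, hb⟩ := h.exists_log_bounds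
  refine ⟨σ, hσ, fun t => ?_⟩
  have hlog : Tendsto (fun n : ℕ => Real.log n) atTop atTop :=
    Real.tendsto_log_atTop.comp tendsto_natCast_atTop_atTop
  have hinv : Tendsto (fun n : ℕ => (Real.log n)⁻¹) atTop (𝓝 0) := hlog.inv_tendsto_atTop
  have hsqrt : Tendsto (fun n : ℕ => √(Real.log n)) atTop atTop :=
    Real.tendsto_sqrt_atTop.comp hlog
  set τ : ℕ → ℝ := fun n => (√σ * √(Real.log n))⁻¹ * t with hτ
  have hrew : ∀ n, charFun ((ν n).map fun x => (x - meanRounds ν n) / (√σ * √(Real.log n))) t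
      = charFun ((ν n).map fun x => x - meanRounds ν n) (τ n) := by
    intro n
    have hmap : (ν n).map (fun x => (x - meanRounds ν n) / (√σ * √(Real.log n)))
        = ((ν n).map fun x => x - meanRounds ν n).map fun x => (√σ * √(Real.log n))⁻¹ * x := by
      rw [Measure.map_map (by fun_prop) (by fun_prop)]
      congr 1
      ext x
      simp [div_eq_inv_mul]
    rw [hmap, charFun_map_mul]
  simp_rw [hrew]
  have hratio : Tendsto (fun n : ℕ => varRounds ν n * (Real.log n)⁻¹) atTop (𝓝 σ) := by
    have h1 : Tendsto (fun n : ℕ => M * (Real.log n)⁻¹) atTop (𝓝 0) := by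
      simpa using hinv.const_mul M
    rw [← sub_zero σ, ← tendsto_sub_nhds_zero_iff]
    refine squeeze_zero_norm' ?_ h1
    filter_upwards [hlog.eventually_gt_atTop 0, eventually_ge_atTop 1] with n hn hn1
    rw [sub_zero, Real.norm_eq_abs, show varRounds ν n * (Real.log n)⁻¹ - σ
      = (varRounds ν n - σ * Real.log n) * (Real.log n)⁻¹ by field_simp, abs_mul,
      abs_of_pos (inv_pos.2 hn)]
    gcongr
    exact (hb n hn1).1
  have hτ2 : ∀ᶠ n in atTop, varRounds ν n * (τ n) ^ 2
      = σ⁻¹ * t ^ 2 * (varRounds ν n * (Real.log n)⁻¹) := by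
    filter_upwards [hlog.eventually_gt_atTop 0] with n hn
    simp only [hτ]
    rw [mul_pow, inv_pow, mul_pow, Real.sq_sqrt hσ.le, Real.sq_sqrt hn.le, mul_inv]
    ring
  have hgauss : Tendsto (fun n => charFun (gaussianReal 0 (varRounds ν n).toNNReal) (τ n)) atTop
      (𝓝 (charFun (gaussianReal 0 1) t)) := by
    have h1 : Tendsto (fun n => varRounds ν n * (τ n) ^ 2) atTop (𝓝 (t ^ 2)) := by
      have := hratio.const_mul (σ⁻¹ * t ^ 2)
      rw [show σ⁻¹ * t ^ 2 * σ = t ^ 2 by field_simp] at this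
      exact this.congr' (hτ2.mono fun n hn => hn.symm)
    have h2 : ∀ n, charFun (gaussianReal 0 (varRounds ν n).toNNReal) (τ n)
        = ((Real.exp (-(varRounds ν n * (τ n) ^ 2) / 2) : ℝ) : ℂ) := by
      intro n
      rw [charFun_gaussianReal, Real.coe_toNNReal _ (varRounds_nonneg ν n)]
      push_cast
      congr 1
      ring
    have h3 : charFun (gaussianReal 0 1) t = ((Real.exp (-(t ^ 2) / 2) : ℝ) : ℂ) := by
      rw [charFun_gaussianReal]
      push_cast
      congr 1
      ring
    simp_rw [h2]
    rw [h3]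
    exact (Complex.continuous_ofReal.tendsto _).comp
      ((Real.continuous_exp.tendsto _).comp (h1.neg.div_const 2))
  have hdiff : Tendsto (fun n => charFun ((ν n).map fun x => x - meanRounds ν n) (τ n)
      - charFun (gaussianReal 0 (varRounds ν n).toNNReal) (τ n)) atTop (𝓝 0) := by
    have h1 : Tendsto (fun n : ℕ => 2 * |t| ^ 3 * (D + K) * (√σ ^ 3)⁻¹ * (√(Real.log n))⁻¹) atTop
        (𝓝 0) := by
      simpa using hsqrt.inv_tendsto_atTop.const_mul (2 * |t| ^ 3 * (D + K) * (√σ ^ 3)⁻¹)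
    refine squeeze_zero_norm' ?_ h1
    filter_upwards [hlog.eventually_ge_atTop 1, eventually_ge_atTop 1] with n hn hn1
    refine (h.norm_charFun_sub_le n _).trans ?_
    have hl : 0 < √(Real.log n) := Real.sqrt_pos.2 (by linarith)
    have hσ' : 0 < √σ := Real.sqrt_pos.2 hσ
    have h2 : gaussianDist ν n ≤ (D + K) * √(Real.log n) ^ 2 := by
      rw [Real.sq_sqrt (by linarith)]
      have := mul_le_mul_of_nonneg_left hn hD
      linarith [(hb n hn1).2]
    calc 2 * |τ n| ^ 3 * gaussianDist ν n
        ≤ 2 * |τ n| ^ 3 * ((D + K) * √(Real.log n) ^ 2) := by gcongr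
      _ = _ := by
        simp only [hτ]
        rw [abs_mul, abs_of_pos (by positivity)]
        field_simp
  simpa using hdiff.add hgauss

end

end MaxFinding

/-- Central limit law for the number of rounds of the maximum-finding Algorithm A, with the rate
`O(1 / √(ln n))` for the Zolotarev metric `ζ₃`. -/
theorem corollary5p3 {Ω : Type*} [MeasurableSpace Ω] (P : Measure Ω) [IsProbabilityMeasure P]
    (Y : ℕ → Ω → ℝ) (hY : MaxFinding.IsRounds P Y) :
    (∀ n, MemLp (Y n) 3 P) ∧
    (∃ C : ℝ, 0 < C ∧
      TendstoInDistribution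
        (fun n ω => (Y n ω - ∫ ω', Y n ω' ∂P) / (√C * √(Real.log n))) atTop
        (id : ℝ → ℝ) (fun _ => P) (gaussianReal 0 1)) ∧
    (∃ K : ℝ, ∀ᶠ n : ℕ in atTop,
      MaxFinding.zolotarev3
        (P.map (fun ω => (Y n ω - ∫ ω', Y n ω' ∂P) / √(variance (Y n) P)))
        (gaussianReal 0 1) ≤ ENNReal.ofReal (K / √(Real.log n))) := by
  have h := hY.isRoundsLaw
  have hm := hY.aemeasurable
  have hmean : ∀ n, ∫ ω, Y n ω ∂P = MaxFinding.meanRounds (fun n => P.map (Y n)) n := fun n => by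
    rw [MaxFinding.meanRounds, integral_map (hm n) (by fun_prop)]
  have hvar : ∀ n, variance (Y n) P = MaxFinding.varRounds (fun n => P.map (Y n)) n := fun n => by
    rw [MaxFinding.varRounds, integral_map (hm n) (by fun_prop), variance_eq_integral (hm n), hmean]
  have hmap : ∀ n (c : ℝ), P.map (fun ω => (Y n ω - ∫ ω', Y n ω' ∂P) / c)
      = (P.map (Y n)).map fun x => (x - MaxFinding.meanRounds (fun n => P.map (Y n)) n) / c :=
    fun n c => by
      rw [AEMeasurable.map_map_of_aemeasurable (by fun_prop) (hm n), hmean]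
      rfl
  refine ⟨fun n => ?_, ?_, ?_⟩
  · rw [← integrable_norm_rpow_iff (hm n).aestronglyMeasurable (by norm_num) (by norm_num)]
    have h1 := h.integrable_abs_cube n
    rw [integrable_map_measure (by fun_prop) (hm n)] at h1
    refine h1.congr (ae_of_all _ fun ω => ?_)
    simp only [Function.comp_apply, Real.norm_eq_abs, ENNReal.toReal_ofNat]
    norm_cast
  · obtain ⟨C, hC, hlim⟩ := h.exists_tendsto_charFun
    refine ⟨C, hC, ⟨fun n => ((hm n).sub_const _).div_const _, aemeasurable_id, ?_⟩⟩
    refine ProbabilityMeasure.tendsto_iff_tendsto_charFun.2 fun t => ?_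
    simp only [ProbabilityMeasure.coe_mk, Measure.map_id, hmap]
    exact hlim t
  · obtain ⟨K, hK⟩ := h.exists_zolotarev3_le
    refine ⟨K, hK.mono fun n hn => ?_⟩
    rw [hmap, hvar]
    exact hn
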